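/- Let $\ell\ge 0$ be an integer and put $n=2\ell+1$. Let $\beta(x,y)=x^{T}S_{n}y$ be the non-degenerate symmetric bilinear form on $\mathbb{C}^{n}$, where $S_{n}$ is the permutation matrix that maps $e_i$ to $e_{n+1-i}$ for $i=1,\dots,n$. Let $SO(2\ell+1)=\{g\in SL(n,\mathbb{C}) : \beta(gx,gy)=\beta(x,y)\ \forall x,y\in\mathbb{C}^n\}$, let $\mathfrak{so}(2\ell+1)$ be its Lie algebra, i.e. the Lie algebra of all complex $n\times n$ matrices $Z$ with $\beta(Zx,y)=-\beta(x,Zy)$ for all $x,y$, and let $\mathcal{B}_{\mathfrak{so}(2\ell+1)}$ be its flag variety, i.e. the variety of all Borel (maximal solvable) subalgebras of $\mathfrak{so}(2\ell+1)$, on which $SO(2\ell+1)$ acts by the adjoint action $\mathrm{Ad}(g)X=gXg^{-1}$. Embed $SO(2\ell)$ in $SO(2\ell+1)$ as the subgroup of the elements that fix the middle basis vector $e_{\ell+1}$, and let $B_{SO(2\ell)}$ be its standard Borel subgroup, which consists of the upper triangular matrices in this subgroup. Then the number of $B_{SO(2\ell)}$-orbits on $\mathcal{B}_{\mathfrak{so}(2\ell+1)}$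 is $$|B_{SO(2\ell)}\backslash \mathcal{B}_{\mathfrak{so}(2\ell+1)}|=\sum_{k=1}^{\ell+1}\frac{\ell!}{(k-1)!}\binom{\ell}{k-1}2^{\ell-k+1}.$$ -/

import Mathlib

open scoped Matrix Nat

-- The Lie bracket on square matrices is the commutator.
attribute [local instance 100] LieRing.ofAssociativeRing

noncomputable section

namespace FlagOrbits

/-- The permutation matrix `S_n` of size `n` that exchanges the `i`-th and the `(n+1-i)`-th
standard basis vectors. -/
def antidiag (n : ℕ) : Matrix (Fin n) (Fin n) ℂ :=
  Matrix.of fun i j => if j = i.rev then 1 else 0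

/-- The non-degenerate symmetric bilinear form `β(x, y) = xᵀ S_n y` on `ℂⁿ`. -/
def beta {n : ℕ} (x y : Fin n → ℂ) : ℂ := x ⬝ᵥ (antidiag n *ᵥ y)

/-- The special orthogonal group `SO(n)` of the form `β`, as a subgroup of `SL(n, ℂ)`. -/
def SO (n : ℕ) : Subgroup (Matrix.SpecialLinearGroup (Fin n) ℂ) where
  carrier := {g | ∀ x y : Fin n → ℂ, beta (g.1 *ᵥ x) (g.1 *ᵥ y) = beta x y}
  mul_mem' := by
    intro a b ha hb x y
    have h := ha (b.1 *ᵥ x) (b.1 *ᵥ y)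
    rw [hb x y] at h
    simpa [Matrix.mulVec_mulVec] using h
  one_mem' := by
    intro x y
    simp
  inv_mem' := by
    intro a ha x y
    have e : ∀ z : Fin n → ℂ, a.1 *ᵥ (a⁻¹.1 *ᵥ z) = z := by
      intro z
      have h1 : a.1 * a⁻¹.1 = 1 := congrArg Subtype.val (mul_inv_cancel a)
      rw [Matrix.mulVec_mulVec, h1, Matrix.one_mulVec]
    have h := ha (a⁻¹.1 *ᵥ x) (a⁻¹.1 *ᵥ y)
    rw [e, e] at h
    exact h.symm

/-- The Lie algebra `𝔰𝔬(n)` of all complex `n × n` matrices that are skew-adjoint with respect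
to `β`. -/
abbrev so (n : ℕ) : LieSubalgebra ℂ (Matrix (Fin n) (Fin n) ℂ) :=
  skewAdjointMatricesLieSubalgebra (antidiag n)

theorem mem_so_iff {n : ℕ} (Z : Matrix (Fin n) (Fin n) ℂ) :
    Z ∈ so n ↔ ∀ x y : Fin n → ℂ, beta (Z *ᵥ x) y = - beta x (Z *ᵥ y) := by
  have key : (∀ x y : Fin n → ℂ, beta (Z *ᵥ x) y = - beta x (Z *ᵥ y)) ↔
      ∀ x y : Fin n → ℂ, x ⬝ᵥ ((Zᵀ * antidiag n) *ᵥ y) = x ⬝ᵥ ((antidiag n * -Z) *ᵥ y) := by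
    refine forall_congr' fun x => forall_congr' fun y => ?_
    rw [beta, beta, ← Matrix.mulVec_mulVec, ← Matrix.mulVec_mulVec, Matrix.neg_mulVec,
      Matrix.mulVec_neg, dotProduct_neg, ← Matrix.vecMul_transpose, Matrix.dotProduct_mulVec x Zᵀ]
  rw [key, mem_skewAdjointMatricesLieSubalgebra, mem_skewAdjointMatricesSubmodule,
    Matrix.IsSkewAdjoint, Matrix.IsAdjointPair]
  constructor
  · intro h x y
    rw [h]
  · intro h
    ext i j
    simpa using h (Pi.single i 1) (Pi.single j 1)

theorem conj_mem_so {n : ℕ} {g : Matrix.SpecialLinearGroup (Fin n) ℂ} (hg : g ∈ SO n)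
    {Z : Matrix (Fin n) (Fin n) ℂ} (hZ : Z ∈ so n) : g.1 * Z * g⁻¹.1 ∈ so n := by
  rw [mem_so_iff] at hZ ⊢
  intro x y
  have e : ∀ z : Fin n → ℂ, g.1 *ᵥ (g⁻¹.1 *ᵥ z) = z := by
    intro z
    have h1 : g.1 * g⁻¹.1 = 1 := congrArg Subtype.val (mul_inv_cancel g)
    rw [Matrix.mulVec_mulVec, h1, Matrix.one_mulVec]
  have h1 := hg (Z *ᵥ (g⁻¹.1 *ᵥ x)) (g⁻¹.1 *ᵥ y)
  have h2 := hg (g⁻¹.1 *ᵥ x) (Z *ᵥ (g⁻¹.1 *ᵥ y))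
  rw [e] at h1 h2
  simp only [← Matrix.mulVec_mulVec]
  rw [h1, h2, hZ]

/-- The adjoint action `Ad(g) X = g X g⁻¹` of `g ∈ SO(n)` on `𝔰𝔬(n)`. -/
def Ad {n : ℕ} (g : SO n) : so n →ₗ⁅ℂ⁆ so n where
  toFun X := ⟨g.1.1 * X.1 * g.1⁻¹.1, conj_mem_so g.2 X.2⟩
  map_add' X Y := by
    apply Subtype.ext
    simp [mul_add, add_mul]
  map_smul' c X := by
    apply Subtype.ext
    simp
  map_lie' := by
    intro X Y
    apply Subtype.ext
    have h1 : g.1⁻¹.1 * g.1.1 = 1 := congrArg Subtype.val (inv_mul_cancel g.1)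
    have h2 : ∀ A B : Matrix (Fin n) (Fin n) ℂ,
        g.1.1 * A * g.1⁻¹.1 * (g.1.1 * B * g.1⁻¹.1) = g.1.1 * (A * B) * g.1⁻¹.1 := by
      intro A B
      calc g.1.1 * A * g.1⁻¹.1 * (g.1.1 * B * g.1⁻¹.1)
          = g.1.1 * A * (g.1⁻¹.1 * g.1.1) * B * g.1⁻¹.1 := by simp only [mul_assoc]
        _ = g.1.1 * (A * B) * g.1⁻¹.1 := by rw [h1]; simp only [mul_assoc, one_mul]
    simp only [LieSubalgebra.coe_bracket, Ring.lie_def, h2, mul_sub, sub_mul]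

theorem Ad_one {n : ℕ} (X : so n) : Ad (1 : SO n) X = X := by
  apply Subtype.ext
  simp [Ad]

theorem Ad_mul {n : ℕ} (g h : SO n) (X : so n) : Ad (g * h) X = Ad g (Ad h X) := by
  apply Subtype.ext
  change (g * h).1.1 * X.1 * (g * h).1⁻¹.1
    = g.1.1 * (h.1.1 * X.1 * h.1⁻¹.1) * g.1⁻¹.1
  have h1 : (g * h).1.1 = g.1.1 * h.1.1 := rfl
  have h2 : (g * h).1⁻¹.1 = h.1⁻¹.1 * g.1⁻¹.1 :=
    congrArg Subtype.val (mul_inv_rev g.1 h.1)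
  rw [h1, h2]
  simp only [mul_assoc]

/-- A Borel subalgebra is a maximal solvable Lie subalgebra. -/
def IsBorel {n : ℕ} (b : LieSubalgebra ℂ (so n)) : Prop :=
  Maximal (fun c : LieSubalgebra ℂ (so n) => LieAlgebra.IsSolvable c) b

/-- The flag variety `𝓑_n` of `𝔰𝔬(n)`: the set of all Borel subalgebras of `𝔰𝔬(n)`. -/
def FlagVariety (n : ℕ) : Type := {b : LieSubalgebra ℂ (so n) // IsBorel b}

theorem map_Ad_one {n : ℕ} (b : LieSubalgebra ℂ (so n)) : b.map (Ad (1 : SO n)) = b := by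
  ext X
  simp [LieSubalgebra.mem_map, Ad_one]

theorem map_Ad_mul {n : ℕ} (g h : SO n) (b : LieSubalgebra ℂ (so n)) :
    b.map (Ad (g * h)) = (b.map (Ad h)).map (Ad g) := by
  ext X
  simp only [LieSubalgebra.mem_map, Ad_mul]
  constructor
  · rintro ⟨Y, hY, rfl⟩
    exact ⟨Ad h Y, ⟨Y, hY, rfl⟩, rfl⟩
  · rintro ⟨_, ⟨Y, hY, rfl⟩, rfl⟩
    exact ⟨Y, hY, rfl⟩

theorem map_mono {n : ℕ} (g : SO n) {b c : LieSubalgebra ℂ (so n)} (h : b ≤ c) :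
    b.map (Ad g) ≤ c.map (Ad g) := by
  intro X hX
  rw [LieSubalgebra.mem_map] at hX ⊢
  obtain ⟨Y, hY, rfl⟩ := hX
  exact ⟨Y, h hY, rfl⟩

theorem isSolvable_map {n : ℕ} (g : SO n) (b : LieSubalgebra ℂ (so n))
    (hb : LieAlgebra.IsSolvable b) : LieAlgebra.IsSolvable (b.map (Ad g)) := by
  have hr : b.map (Ad g) = ((Ad g).comp b.incl).range := by
    ext X
    simp [LieSubalgebra.mem_map]
  rw [hr]
  infer_instance

theorem isBorel_map {n : ℕ} (g : SO n) {b : LieSubalgebra ℂ (so n)} (hb : IsBorel b) :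
    IsBorel (b.map (Ad g)) := by
  refine ⟨isSolvable_map g b hb.1, fun c hc hle => ?_⟩
  have h1 : b ≤ c.map (Ad g⁻¹) := by
    have h := map_mono g⁻¹ hle
    rwa [← map_Ad_mul, inv_mul_cancel, map_Ad_one] at h
  have h2 := map_mono g (hb.2 (isSolvable_map g⁻¹ c hc) h1)
  rwa [← map_Ad_mul, mul_inv_cancel, map_Ad_one] at h2

/-- `SO(n)` acts on the flag variety of `𝔰𝔬(n)` by the adjoint action, `g • 𝔟 = Ad(g) 𝔟`. -/
instance (n : ℕ) : MulAction (SO n) (FlagVariety n) where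
  smul g b := ⟨b.1.map (Ad g), isBorel_map g b.2⟩
  one_smul b := Subtype.ext (map_Ad_one b.1)
  mul_smul g h b := Subtype.ext (map_Ad_mul g h b.1)

/-- The middle standard basis vector `e_0 = e_{ℓ+1}` of `ℂ^{2ℓ+1}`. -/
def e0 (l : ℕ) : Fin (2 * l + 1) → ℂ := Pi.single ⟨l, by omega⟩ 1

/-- The symmetric subgroup `K = SO(2ℓ)` of `SO(2ℓ+1)`: the elements that fix `e_0`. They act
on the orthogonal complement of `e_0`, which has dimension `2ℓ` and on which the restriction of
`β` is again the standard form. -/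
def SOEven (l : ℕ) : Subgroup (SO (2 * l + 1)) where
  carrier := {g | g.1.1 *ᵥ e0 l = e0 l}
  mul_mem' := by
    intro a b ha hb
    change (a.1.1 * b.1.1) *ᵥ e0 l = e0 l
    rw [← Matrix.mulVec_mulVec, hb, ha]
  one_mem' := by
    change (1 : Matrix (Fin (2 * l + 1)) (Fin (2 * l + 1)) ℂ) *ᵥ e0 l = e0 l
    exact Matrix.one_mulVec _
  inv_mem' := by
    intro a ha
    have h1 : a.1⁻¹.1 * a.1.1 = 1 := congrArg Subtype.val (inv_mul_cancel a.1)
    change a.1⁻¹.1 *ᵥ e0 l = e0 l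
    have ha' : a.1.1 *ᵥ e0 l = e0 l := ha
    conv_lhs => rw [← ha']
    rw [Matrix.mulVec_mulVec, h1, Matrix.one_mulVec]

/-- The standard Borel subgroup of `SO(n)`: its upper triangular elements. -/
def borelSubgroup (n : ℕ) : Subgroup (SO n) where
  carrier := {g | g.1.1.BlockTriangular id}
  mul_mem' := by
    intro a b ha hb
    exact Matrix.BlockTriangular.mul ha hb
  one_mem' := Matrix.blockTriangular_one
  inv_mem' := by
    intro a ha
    have ha' : a.1.1.BlockTriangular id := ha
    have h1 : a.1.1 * a.1⁻¹.1 = 1 := congrArg Subtype.val (mul_inv_cancel a.1)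
    have h2 : a.1⁻¹.1 = (a.1.1)⁻¹ := (Matrix.inv_eq_right_inv h1).symm
    change a.1⁻¹.1.BlockTriangular id
    rw [h2]
    have : Invertible a.1.1 := Matrix.invertibleOfIsUnitDet _ (by rw [a.1.2]; exact isUnit_one)
    exact Matrix.blockTriangular_inv_of_blockTriangular ha'

/-- The standard Borel subgroup `B_{SO(2ℓ)} = K ∩ B_{2ℓ+1}` of `K = SO(2ℓ)`: the upper
triangular elements of `K`. -/
def borelSOEven (l : ℕ) : Subgroup (SO (2 * l + 1)) := SOEven l ⊓ borelSubgroup (2 * l + 1)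

end FlagOrbits

end

noncomputable section

namespace FlagOrbits

/-! Borel subalgebras of `so (2 * l + 1)` are the stabilizers of complete isotropic flags, so the
problem is to count orbits of the Borel subgroup of `SO(2ℓ)` on such flags. One inclusion is Lie's
theorem: a solvable subalgebra stabilizes such a flag (`exists_isotropic_stable`). Conversely,
stabilizers of these flags are solvable, being conjugate to upper triangular matrices, and a flag is
determined by its stabilizer (`flagSpan_eq_of_stab_le`), which makes them maximal.

The orbits are separated by a normal form. Column reduction within a flag gives a spanning sequence
with distinct pivots `w i`; by isotropy no two pivots are opposite, so `w` is a signed permutation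
recording a Bruhat cell. The group also fixes `e0`, so the `e0`-coordinates matter. A nonzero
coordinate of the `j`-th vector can clear that of the `i`-th, keeping flag and pivots, when `j < i`
and `w j < w i`. The remaining nonzero coordinates are scaled to `1`; they sit on a set `S` on which
`w` is decreasing and lies above the middle index (`IsIsotropic.exists_normalForm`,
`NormalForm.mid_lt`).

The pair `(w, S)` depends only on the flag (`NormalForm.eq_of_flagSpan_eq`) and is preserved by the
group. It is a complete invariant: a normal form extends to a Witt basis given by an upper
triangular isometry whose preimage of `e0` depends only on `(w, S)` (`NormalForm.exists_borel`), so
two such isometries differ by an element fixing `e0`. Every permitted pair occurs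
(`NormalForm.exists_of_admissible`).

For `S` of size `j` there are `l.choose j` sets, `l! / j!` permutations decreasing on `S`, and `2 ^
(l - j)` free signs off `S`. Summing over `j = k - 1` gives the formula. -/

/-! ### The bilinear form -/

/-- The form `β` as a bundled bilinear form. -/
def betaForm (n : ℕ) : LinearMap.BilinForm ℂ (Fin n → ℂ) := Matrix.toBilin' (antidiag n)

theorem beta_eq_betaForm {n : ℕ} (x y : Fin n → ℂ) : beta x y = betaForm n x y := by
  rw [betaForm, Matrix.toBilin'_apply', beta]

theorem antidiag_mulVec {n : ℕ} (y : Fin n → ℂ) (i : Fin n) : (antidiag n *ᵥ y) i = y i.rev := by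
  simp [antidiag, Matrix.mulVec, dotProduct]

theorem beta_eq_sum {n : ℕ} (x y : Fin n → ℂ) : beta x y = ∑ i, x i * y i.rev := by
  simp only [beta, dotProduct, antidiag_mulVec]

theorem beta_comm {n : ℕ} (x y : Fin n → ℂ) : beta x y = beta y x := by
  rw [beta_eq_sum, beta_eq_sum, ← Equiv.sum_comp Fin.revPerm]
  simp [mul_comm]

theorem beta_add_left {n : ℕ} (x y z : Fin n → ℂ) : beta (x + y) z = beta x z + beta y z := by
  simp [beta_eq_betaForm]

theorem beta_add_right {n : ℕ} (x y z : Fin n → ℂ) : beta x (y + z) = beta x y + beta x z := by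
  simp [beta_eq_betaForm]

theorem beta_sub_left {n : ℕ} (x y z : Fin n → ℂ) : beta (x - y) z = beta x z - beta y z := by
  simp [beta_eq_betaForm]

theorem beta_sub_right {n : ℕ} (x y z : Fin n → ℂ) : beta x (y - z) = beta x y - beta x z := by
  simp [beta_eq_betaForm]

theorem beta_smul_left {n : ℕ} (c : ℂ) (x y : Fin n → ℂ) : beta (c • x) y = c * beta x y := by
  simp [beta_eq_betaForm]

theorem beta_smul_right {n : ℕ} (c : ℂ) (x y : Fin n → ℂ) : beta x (c • y) = c * beta x y := by
  simp [beta_eq_betaForm]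

theorem beta_sum_left {n : ℕ} {ι : Type*} (s : Finset ι) (f : ι → Fin n → ℂ) (y : Fin n → ℂ) :
    beta (∑ i ∈ s, f i) y = ∑ i ∈ s, beta (f i) y := by
  simp [beta_eq_betaForm]

theorem beta_sum_right {n : ℕ} {ι : Type*} (s : Finset ι) (x : Fin n → ℂ) (f : ι → Fin n → ℂ) :
    beta x (∑ i ∈ s, f i) = ∑ i ∈ s, beta x (f i) := by
  simp [beta_eq_betaForm]

theorem beta_single_right {n : ℕ} (x : Fin n → ℂ) (i : Fin n) :
    beta x (Pi.single i 1) = x i.rev := by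
  rw [beta_comm, beta_eq_sum]
  simp [Pi.single_apply]

theorem beta_single_left {n : ℕ} (x : Fin n → ℂ) (i : Fin n) :
    beta (Pi.single i 1) x = x i.rev := by
  rw [beta_comm, beta_single_right]

theorem beta_mem_span_eq_zero {n : ℕ} {s : Set (Fin n → ℂ)} {x y : Fin n → ℂ}
    (h : ∀ z ∈ s, beta x z = 0) (hy : y ∈ Submodule.span ℂ s) : beta x y = 0 := by
  have h1 : Submodule.span ℂ s ≤ LinearMap.ker (betaForm n x) := by
    rw [Submodule.span_le]
    intro z hz
    simpa [← beta_eq_betaForm] using h z hz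
  simpa [← beta_eq_betaForm] using h1 hy

/-! ### Pivots -/

/-- The pivot of a vector is the index of its last nonzero coordinate. -/
def HasPivot {n : ℕ} (x : Fin n → ℂ) (r : Fin n) : Prop := x r ≠ 0 ∧ ∀ s, r < s → x s = 0

theorem exists_hasPivot {n : ℕ} {x : Fin n → ℂ} (hx : x ≠ 0) : ∃ r, HasPivot x r := by
  classical
  obtain ⟨i, hi⟩ := Function.ne_iff.1 hx
  have hne : (Finset.univ.filter fun r => x r ≠ 0).Nonempty := ⟨i, by simpa using hi⟩
  refine ⟨Finset.max' _ hne, by simpa using Finset.max'_mem _ hne, fun s hs => ?_⟩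
  by_contra h
  exact absurd (Finset.le_max' (Finset.univ.filter fun r => x r ≠ 0) s (by simpa using h))
    (not_le.2 hs)

theorem HasPivot.unique {n : ℕ} {x : Fin n → ℂ} {r s : Fin n} (hr : HasPivot x r)
    (hs : HasPivot x s) : r = s := by
  rcases lt_trichotomy r s with h | h | h
  · exact absurd (hr.2 s h) hs.1
  · exact h
  · exact absurd (hs.2 r h) hr.1

theorem HasPivot.ne_zero {n : ℕ} {x : Fin n → ℂ} {r : Fin n} (hr : HasPivot x r) : x ≠ 0 := by
  rintro rfl
  exact hr.1 rfl

theorem HasPivot.smul {n : ℕ} {x : Fin n → ℂ} {r : Fin n} (hr : HasPivot x r) {c : ℂ}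
    (hc : c ≠ 0) : HasPivot (c • x) r :=
  ⟨by simpa [hc] using hr.1, fun s hs => by simp [hr.2 s hs]⟩

/-- A term at index `i` survives only if `i ≤ r` and `i.rev ≤ r.rev`, so the sum reduces to the term
at `r`. This is what prevents mutually orthogonal vectors from having opposite pivots. -/
theorem HasPivot.beta_ne_zero {n : ℕ} {x y : Fin n → ℂ} {r : Fin n} (hx : HasPivot x r)
    (hy : HasPivot y r.rev) : beta x y ≠ 0 := by
  rw [beta_eq_sum, Finset.sum_eq_single r]
  · exact mul_ne_zero hx.1 hy.1
  · intro i _ hi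
    rcases lt_or_gt_of_ne hi with h | h
    · rw [hy.2 _ (Fin.rev_lt_rev.2 h), mul_zero]
    · rw [hx.2 _ h, zero_mul]
  · simp

/-- A nontrivial combination of vectors with distinct pivots has as its pivot the largest pivot
that occurs. -/
theorem exists_hasPivot_sum {n : ℕ} {ι : Type*} [Fintype ι] {v : ι → Fin n → ℂ} {w : ι → Fin n}
    (hv : ∀ i, HasPivot (v i) (w i)) (hw : Function.Injective w) {c : ι → ℂ} (hc : c ≠ 0) :
    ∃ i, c i ≠ 0 ∧ HasPivot (∑ j, c j • v j) (w i) ∧ ∀ j, c j ≠ 0 → w j ≤ w i := by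
  classical
  obtain ⟨i₀, hi₀⟩ := Function.ne_iff.1 hc
  obtain ⟨i, hi, hmax⟩ := Finset.exists_max_image (Finset.univ.filter fun i => c i ≠ 0) w
    ⟨i₀, by simpa using hi₀⟩
  have hi' : c i ≠ 0 := by simpa using hi
  have hmax' : ∀ j, c j ≠ 0 → w j ≤ w i := fun j hj => hmax j (by simpa using hj)
  refine ⟨i, hi', ⟨?_, fun s hs => ?_⟩, hmax'⟩
  · rw [Finset.sum_apply, Finset.sum_eq_single i]
    · exact mul_ne_zero hi' (hv i).1
    · intro j _ hj
      by_cases hcj : c j = 0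
      · simp [hcj]
      · have : w j < w i := lt_of_le_of_ne (hmax' j hcj) (fun h => hj (hw h))
        simp [(hv j).2 _ this]
    · simp
  · rw [Finset.sum_apply]
    refine Finset.sum_eq_zero fun j _ => ?_
    by_cases hcj : c j = 0
    · simp [hcj]
    · simp [(hv j).2 s ((hmax' j hcj).trans_lt hs)]

theorem linearIndependent_of_hasPivot {n : ℕ} {ι : Type*} [Fintype ι] {v : ι → Fin n → ℂ}
    {w : ι → Fin n} (hv : ∀ i, HasPivot (v i) (w i)) (hw : Function.Injective w) :
    LinearIndependent ℂ v := by
  rw [Fintype.linearIndependent_iff]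
  intro c hc
  by_contra! h
  obtain ⟨i, hi⟩ := h
  obtain ⟨_, -, h2, -⟩ := exists_hasPivot_sum hv hw (c := c) (fun h => hi (congrFun h i))
  exact h2.ne_zero hc

/-! ### Flags spanned by sequences of vectors -/

/-- The span of the vectors `v j` with `j ≤ i`. -/
def flagSpan {n k : ℕ} (v : Fin k → Fin n → ℂ) (i : Fin k) : Submodule ℂ (Fin n → ℂ) :=
  Submodule.span ℂ (v '' Set.Iic i)

theorem flagSpan_mono {n k : ℕ} (v : Fin k → Fin n → ℂ) {i j : Fin k} (h : i ≤ j) :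
    flagSpan v i ≤ flagSpan v j :=
  Submodule.span_mono (Set.image_mono (Set.Iic_subset_Iic.2 h))

theorem mem_flagSpan {n k : ℕ} (v : Fin k → Fin n → ℂ) {i j : Fin k} (h : i ≤ j) :
    v i ∈ flagSpan v j :=
  Submodule.subset_span ⟨i, h, rfl⟩

theorem flagSpan_le_iff {n k : ℕ} {v : Fin k → Fin n → ℂ} {i : Fin k}
    {P : Submodule ℂ (Fin n → ℂ)} : flagSpan v i ≤ P ↔ ∀ j ≤ i, v j ∈ P := by
  rw [flagSpan, Submodule.span_le]
  constructor
  · exact fun h j hj => h ⟨j, hj, rfl⟩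
  · rintro h _ ⟨j, hj, rfl⟩
    exact h j hj

theorem finrank_flagSpan {n k : ℕ} {v : Fin k → Fin n → ℂ} (hv : LinearIndependent ℂ v)
    (i : Fin k) : Module.finrank ℂ (flagSpan v i) = i + 1 := by
  have h := finrank_span_eq_card (hv.comp (Subtype.val : Set.Iic i → Fin k)
    Subtype.val_injective)
  rw [Set.range_comp, Subtype.range_coe] at h
  rw [flagSpan, h, ← Nat.card_eq_fintype_card, Nat.card_coe_set_eq, ← Finset.coe_Iic,
    Set.ncard_coe_finset, Fin.card_Iic]

theorem flagSpan_eq_of_mem {n k : ℕ} {v v' : Fin k → Fin n → ℂ} (hv : LinearIndependent ℂ v)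
    (hv' : LinearIndependent ℂ v') (h : ∀ i, v' i ∈ flagSpan v i) : flagSpan v' = flagSpan v := by
  funext i
  refine Submodule.eq_of_le_of_finrank_eq ?_ ?_
  · exact flagSpan_le_iff.2 fun j hj => flagSpan_mono v hj (h j)
  · rw [finrank_flagSpan hv, finrank_flagSpan hv']

theorem mem_flagSpan_iff {n k : ℕ} {v : Fin k → Fin n → ℂ} {i : Fin k} {x : Fin n → ℂ} :
    x ∈ flagSpan v i ↔ ∃ c : Fin k → ℂ, (∀ j, c j ≠ 0 → j ≤ i) ∧ x = ∑ j, c j • v j := by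
  constructor
  · intro hx
    rw [flagSpan] at hx
    induction hx using Submodule.span_induction with
    | mem x hx =>
      obtain ⟨j, hj, rfl⟩ := hx
      refine ⟨Pi.single j 1, fun m hm => ?_, by simp [Pi.single_apply]⟩
      by_contra h
      exact hm (Pi.single_eq_of_ne (fun e => h (e.trans_le hj)) _)
    | zero => exact ⟨0, by simp, by simp⟩
    | add x y _ _ hx hy =>
      obtain ⟨c, hc, rfl⟩ := hx
      obtain ⟨d, hd, rfl⟩ := hy
      refine ⟨c + d, fun j hj => ?_, by simp [add_smul, Finset.sum_add_distrib]⟩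
      by_cases h : c j = 0
      · exact hd j (fun e => hj (by simp [h, e]))
      · exact hc j h
    | smul a x _ hx =>
      obtain ⟨c, hc, rfl⟩ := hx
      exact ⟨a • c, fun j hj => hc j (fun e => hj (by simp [e])), by
        simp [Finset.smul_sum, mul_smul]⟩
  · rintro ⟨c, hc, rfl⟩
    refine Submodule.sum_mem _ fun j _ => ?_
    by_cases h : c j = 0
    · simp [h]
    · exact Submodule.smul_mem _ _ (mem_flagSpan v (hc j h))

theorem beta_eq_zero_of_mem_flagSpan {n k : ℕ} {v : Fin k → Fin n → ℂ} {i : Fin k}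
    {x y : Fin n → ℂ} (h : ∀ j ≤ i, beta x (v j) = 0) (hy : y ∈ flagSpan v i) :
    beta x y = 0 := by
  refine beta_mem_span_eq_zero ?_ hy
  rintro _ ⟨j, hj, rfl⟩
  exact h j hj

/-- A sequence of linearly independent, mutually orthogonal isotropic vectors. -/
structure IsIsotropic {n k : ℕ} (v : Fin k → Fin n → ℂ) : Prop where
  linearIndependent : LinearIndependent ℂ v
  beta_eq_zero : ∀ i j, beta (v i) (v j) = 0

theorem IsIsotropic.beta_flagSpan {n k : ℕ} {v : Fin k → Fin n → ℂ} (hv : IsIsotropic v)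
    {i j : Fin k} {x y : Fin n → ℂ} (hx : x ∈ flagSpan v i) (hy : y ∈ flagSpan v j) :
    beta x y = 0 := by
  refine beta_eq_zero_of_mem_flagSpan (fun m _ => ?_) hy
  rw [beta_comm]
  exact beta_eq_zero_of_mem_flagSpan (fun m' _ => hv.beta_eq_zero _ _) hx

/-! ### Choosing one index from each pair of opposite indices -/

/-- The middle index. -/
def mid (l : ℕ) : Fin (2 * l + 1) := ⟨l, by omega⟩

theorem mid_rev (l : ℕ) : (mid l).rev = mid l := by
  ext
  simp only [mid, Fin.val_rev]
  omega

theorem e0_eq_single (l : ℕ) : e0 l = Pi.single (mid l) 1 := rfl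

theorem beta_e0_right {l : ℕ} (x : Fin (2 * l + 1) → ℂ) : beta x (e0 l) = x (mid l) := by
  rw [e0_eq_single, beta_single_right, mid_rev]

/-- An injective sequence of `l` indices, no two of which are opposite. -/
def Admissible {l : ℕ} (w : Fin l → Fin (2 * l + 1)) : Prop :=
  Function.Injective w ∧ ∀ i j, w i ≠ (w j).rev

theorem Admissible.ne_mid {l : ℕ} {w : Fin l → Fin (2 * l + 1)} (hw : Admissible w) (i : Fin l) :
    w i ≠ mid l := fun h => hw.2 i i (by rw [h, mid_rev])

theorem Admissible.rev_ne_mid {l : ℕ} {w : Fin l → Fin (2 * l + 1)} (hw : Admissible w)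
    (i : Fin l) : (w i).rev ≠ mid l := fun h => hw.ne_mid i (by rw [← mid_rev, ← h, Fin.rev_rev])

/-- The `w i`, their opposites and the middle index are distinct, and there are `2 * l + 1` of them,
so they exhaust all indices. -/
theorem Admissible.prod_eq {l : ℕ} {w : Fin l → Fin (2 * l + 1)} (hw : Admissible w)
    {M : Type*} [CommMonoid M] (f : Fin (2 * l + 1) → M) :
    ∏ r, f r = ((∏ i, f (w i)) * ∏ i, f (w i).rev) * f (mid l) := by
  let e : (Fin l ⊕ Fin l) ⊕ Unit → Fin (2 * l + 1) :=
    Sum.elim (Sum.elim w fun i => (w i).rev) fun _ => mid l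
  have he : Function.Injective e := by
    rintro ((i | i) | i) ((j | j) | j) h <;> simp only [e, Sum.elim_inl, Sum.elim_inr] at h
    · rw [hw.1 h]
    · exact absurd h (hw.2 i j)
    · exact absurd h (hw.ne_mid i)
    · exact absurd h.symm (hw.2 j i)
    · rw [hw.1 (Fin.rev_injective h)]
    · exact absurd h (hw.rev_ne_mid i)
    · exact absurd h.symm (hw.ne_mid j)
    · exact absurd h.symm (hw.rev_ne_mid j)
    · rfl
  have hb : Function.Bijective e := by
    rw [Fintype.bijective_iff_injective_and_card]
    refine ⟨he, ?_⟩
    simp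
    omega
  rw [← Equiv.prod_comp (Equiv.ofBijective e hb)]
  simp [e, Fintype.prod_sum_type]

theorem Admissible.sum_eq {l : ℕ} {w : Fin l → Fin (2 * l + 1)} (hw : Admissible w)
    {M : Type*} [AddCommMonoid M] (f : Fin (2 * l + 1) → M) :
    ∑ r, f r = ((∑ i, f (w i)) + ∑ i, f (w i).rev) + f (mid l) :=
  hw.prod_eq (M := Multiplicative M) f

theorem Admissible.cases {l : ℕ} {w : Fin l → Fin (2 * l + 1)} (hw : Admissible w)
    (r : Fin (2 * l + 1)) : (∃ i, r = w i) ∨ (∃ i, r = (w i).rev) ∨ r = mid l := by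
  by_contra! h
  -- The indicator of an index outside all three classes would sum to `1` on one side and to `0` on
  -- the other.
  have h1 := hw.sum_eq (fun s => if s = r then 1 else 0)
  simp [fun i => (h.1 i).symm, fun i => (h.2.1 i).symm, h.2.2.symm] at h1

/-! ### Isometries with prescribed values -/

/-- A basis of `ℂ^{2l+1}` consisting of `l` hyperbolic pairs and a unit vector. -/
structure IsWittBasis {n l : ℕ} (v z : Fin l → Fin n → ℂ) (y : Fin n → ℂ) : Prop where
  left_left : ∀ i j, beta (v i) (v j) = 0
  right_right : ∀ i j, beta (z i) (z j) = 0
  left_right : ∀ i j, beta (v i) (z j) = if i = j then 1 else 0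
  left_unit : ∀ i, beta (v i) y = 0
  right_unit : ∀ i, beta (z i) y = 0
  unit_unit : beta y y = 1

/-- The linear map that maps the standard basis vectors, grouped by `w`, to the vectors of a given
Witt basis. -/
def wittMap {l : ℕ} (w : Fin l → Fin (2 * l + 1)) (v z : Fin l → Fin (2 * l + 1) → ℂ)
    (y : Fin (2 * l + 1) → ℂ) : (Fin (2 * l + 1) → ℂ) →ₗ[ℂ] Fin (2 * l + 1) → ℂ :=
  (∑ i, (LinearMap.proj (w i)).smulRight (v i)) +
    (∑ i, (LinearMap.proj (w i).rev).smulRight (z i)) + (LinearMap.proj (mid l)).smulRight y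

theorem wittMap_apply {l : ℕ} (w : Fin l → Fin (2 * l + 1)) (v z : Fin l → Fin (2 * l + 1) → ℂ)
    (y x : Fin (2 * l + 1) → ℂ) :
    wittMap w v z y x = (∑ i, x (w i) • v i) + (∑ i, x (w i).rev • z i) + x (mid l) • y := by
  simp [wittMap]

section
variable {l : ℕ} {w : Fin l → Fin (2 * l + 1)} {v z : Fin l → Fin (2 * l + 1) → ℂ}
  {y : Fin (2 * l + 1) → ℂ}

theorem wittMap_single (hw : Admissible w) (i : Fin l) :
    wittMap w v z y (Pi.single (w i) 1) = v i := by
  have h1 : ∀ j, (w j).rev ≠ w i := fun j => (hw.2 i j).symm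
  simp [wittMap_apply, Pi.single_apply, hw.1.eq_iff, h1, (hw.ne_mid i).symm]

theorem wittMap_single_rev (hw : Admissible w) (i : Fin l) :
    wittMap w v z y (Pi.single (w i).rev 1) = z i := by
  simp [wittMap_apply, Pi.single_apply, hw.1.eq_iff, hw.2, (hw.rev_ne_mid i).symm]

theorem wittMap_single_mid (hw : Admissible w) :
    wittMap w v z y (Pi.single (mid l) 1) = y := by
  simp [wittMap_apply, hw.ne_mid, hw.rev_ne_mid]

/-- The standard basis, grouped by `w`, has the same Gram matrix as a Witt basis. -/
theorem beta_wittMap (hw : Admissible w) (h : IsWittBasis v z y) (x x' : Fin (2 * l + 1) → ℂ) :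
    beta (wittMap w v z y x) (wittMap w v z y x') = beta x x' := by
  have h1 : ∀ i j, beta (z i) (v j) = if j = i then 1 else 0 := fun i j => by
    rw [beta_comm, h.left_right]
  have h2 : ∀ i, beta y (v i) = 0 := fun i => by rw [beta_comm, h.left_unit]
  have h3 : ∀ i, beta y (z i) = 0 := fun i => by rw [beta_comm, h.right_unit]
  rw [wittMap_apply, wittMap_apply, beta_eq_sum x, hw.sum_eq]
  simp only [beta_add_left, beta_add_right, beta_sum_left, beta_sum_right, beta_smul_left,
    beta_smul_right, h.left_left, h.right_right, h.left_right, h.left_unit, h.right_unit,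
    h.unit_unit, h1, h2, h3, mid_rev, Fin.rev_rev]
  simp only [mul_ite, mul_one, mul_zero, Finset.sum_ite_eq, Finset.sum_ite_eq', Finset.mem_univ,
    if_true, Finset.sum_const_zero, add_zero, zero_add, mul_comm (x' _)]
  ring

end

theorem det_mul_self_of_isometry {n : ℕ} {M : Matrix (Fin n) (Fin n) ℂ}
    (hM : ∀ x y, beta (M *ᵥ x) (M *ᵥ y) = beta x y) : M.det * M.det = 1 := by
  have h1 : antidiag n * antidiag n = 1 := by
    refine Matrix.ext_of_mulVec_single fun i => ?_
    rw [← Matrix.mulVec_mulVec, Matrix.one_mulVec]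
    ext j
    rw [antidiag_mulVec, Matrix.mulVec_single_one]
    simp [antidiag, Pi.single_apply, eq_comm]
  have h2 : Mᵀ * antidiag n * M = antidiag n := by
    ext i j
    have h := hM (Pi.single i 1) (Pi.single j 1)
    rw [beta, beta, ← Matrix.vecMul_transpose, ← Matrix.dotProduct_mulVec, Matrix.mulVec_mulVec,
      Matrix.mulVec_mulVec] at h
    simpa [Matrix.mul_assoc] using h
  have h3 : (antidiag n).det * (antidiag n).det = 1 := by
    rw [← Matrix.det_mul, h1, Matrix.det_one]
  have h4 := congrArg Matrix.det h2
  rw [Matrix.det_mul, Matrix.det_mul, Matrix.det_transpose] at h4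
  have h5 : (antidiag n).det ≠ 0 := left_ne_zero_of_mul_eq_one h3
  apply mul_right_cancel₀ h5
  linear_combination h4

/-- The standard choice of one index from each pair of opposite indices. -/
def stdIndex {l : ℕ} (i : Fin l) : Fin (2 * l + 1) := ⟨i, by omega⟩

theorem admissible_stdIndex (l : ℕ) : Admissible (stdIndex : Fin l → Fin (2 * l + 1)) := by
  constructor
  · intro i j h
    simpa [stdIndex, Fin.ext_iff] using h
  · intro i j h
    simp only [stdIndex, Fin.ext_iff, Fin.val_rev] at h
    omega

/-- Opposite diagonal entries of a triangular isometry are mutually inverse, so the determinant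
reduces to the middle diagonal entry. -/
theorem det_eq_one_of_blockTriangular {l : ℕ} {M : Matrix (Fin (2 * l + 1)) (Fin (2 * l + 1)) ℂ}
    (hM : ∀ x y, beta (M *ᵥ x) (M *ᵥ y) = beta x y) (ht : M.BlockTriangular id)
    (h0 : M (mid l) (mid l) = 1) : M.det = 1 := by
  have h1 : ∀ r, M r r * M r.rev r.rev = 1 := by
    intro r
    have h := hM (Pi.single r 1) (Pi.single r.rev 1)
    rw [beta_single_left, Pi.single_eq_same, beta_eq_sum, Finset.sum_eq_single r] at h
    · simpa using h
    · intro i _ hi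
      rcases lt_or_gt_of_ne hi with h | h
      · have : M i.rev r.rev = 0 := ht (Fin.rev_lt_rev.2 h)
        simp [this]
      · have : M i r = 0 := ht h
        simp [this]
    · simp
  rw [Matrix.det_of_isUpperTriangular ht, (admissible_stdIndex l).prod_eq, h0,
    ← Finset.prod_mul_distrib]
  simp [h1]

/-- A Witt basis extends to an element of the special orthogonal group, up to the sign of the
unit vector. -/
theorem exists_mem_SO_of_isWittBasis {l : ℕ} {v z : Fin l → Fin (2 * l + 1) → ℂ}
    {y : Fin (2 * l + 1) → ℂ} (h : IsWittBasis v z y) :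
    ∃ g : SO (2 * l + 1), ∀ i, g.1.1 *ᵥ Pi.single (stdIndex i) 1 = v i := by
  have hw := admissible_stdIndex l
  have key : ∀ y', IsWittBasis v z y' → (LinearMap.toMatrix' (wittMap stdIndex v z y')).det = 1 →
      ∃ g : SO (2 * l + 1), ∀ i, g.1.1 *ᵥ Pi.single (stdIndex i) 1 = v i := by
    intro y' hy' hd
    refine ⟨⟨⟨LinearMap.toMatrix' (wittMap stdIndex v z y'), hd⟩, fun a b => ?_⟩, fun i => ?_⟩
    · simp only [LinearMap.toMatrix'_mulVec, beta_wittMap hw hy']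
    · simp only [LinearMap.toMatrix'_mulVec, wittMap_single hw]
  have hd := det_mul_self_of_isometry (M := LinearMap.toMatrix' (wittMap stdIndex v z y))
    (fun a b => by simp only [LinearMap.toMatrix'_mulVec, beta_wittMap hw h])
  rcases mul_self_eq_one_iff.1 hd with hd | hd
  · exact key y h hd
  · refine key (-y) ⟨h.left_left, h.right_right, h.left_right, fun i => ?_, fun i => ?_, ?_⟩ ?_
    · rw [← neg_one_smul ℂ, beta_smul_right, h.left_unit, mul_zero]
    · rw [← neg_one_smul ℂ, beta_smul_right, h.right_unit, mul_zero]
    · rw [← neg_one_smul ℂ, beta_smul_right, beta_smul_left, h.unit_unit]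
      norm_num
    -- Replacing `y` by `-y` negates only the middle column, so it turns determinant `-1` into `1`
    -- without moving any `v i`.
    · have e : LinearMap.toMatrix' (wittMap stdIndex v z (-y)) =
          (LinearMap.toMatrix' (wittMap stdIndex v z y)).updateCol (mid l)
            ((-1 : ℂ) • (LinearMap.toMatrix' (wittMap stdIndex v z y)).col (mid l)) := by
        refine Matrix.ext_of_mulVec_single fun r => ?_
        rw [Matrix.mulVec_single_one, Matrix.mulVec_single_one]
        have e2 : ∀ y' r, (LinearMap.toMatrix' (wittMap stdIndex v z y')).col r =
            wittMap stdIndex v z y' (Pi.single r 1) := fun y' r => by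
          rw [← Matrix.mulVec_single_one, LinearMap.toMatrix'_mulVec]
        rcases eq_or_ne r (mid l) with rfl | hr
        · ext i
          simp [e2, wittMap_single_mid hw]
        · ext i
          have e3 := congrFun (e2 y r) i
          simp only [Matrix.col_apply] at e3
          rw [e2, Matrix.col_apply, Matrix.updateCol_ne hr, e3]
          rcases hw.cases r with ⟨j, rfl⟩ | ⟨j, rfl⟩ | rfl
          · simp only [wittMap_single hw]
          · simp only [wittMap_single_rev hw]
          · exact absurd rfl hr
      rw [e, Matrix.det_updateCol_smul]
      have e4 : (LinearMap.toMatrix' (wittMap stdIndex v z y)).updateCol (mid l)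
          ((LinearMap.toMatrix' (wittMap stdIndex v z y)).col (mid l)) =
            LinearMap.toMatrix' (wittMap stdIndex v z y) := Matrix.updateCol_eq_self _ _
      rw [e4, hd]
      norm_num

theorem SO_inv_mulVec {n : ℕ} (g : SO n) (x : Fin n → ℂ) : g⁻¹.1.1 *ᵥ (g.1.1 *ᵥ x) = x := by
  have h1 : g⁻¹.1.1 * g.1.1 = 1 := congrArg (fun a : SO n => a.1.1) (inv_mul_cancel g)
  rw [Matrix.mulVec_mulVec, h1, Matrix.one_mulVec]

theorem SO_mulVec_inv {n : ℕ} (g : SO n) (x : Fin n → ℂ) : g.1.1 *ᵥ (g⁻¹.1.1 *ᵥ x) = x := by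
  simpa using SO_inv_mulVec g⁻¹ x

/-! ### Normal forms of isotropic sequences -/

/-- A sequence of mutually orthogonal isotropic vectors with distinct pivots `w i` whose `e0`
coordinates are `1` on `S` and `0` elsewhere, with `w` decreasing on `S`. -/
structure NormalForm {l : ℕ} (v : Fin l → Fin (2 * l + 1) → ℂ) (w : Fin l → Fin (2 * l + 1))
    (S : Finset (Fin l)) : Prop where
  hasPivot : ∀ i, HasPivot (v i) (w i)
  injective : Function.Injective w
  beta_eq_zero : ∀ i j, beta (v i) (v j) = 0
  beta_e0 : ∀ i, beta (v i) (e0 l) = if i ∈ S then 1 else 0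
  lt_of_lt : ∀ i ∈ S, ∀ j ∈ S, i < j → w j < w i

namespace NormalForm

variable {l : ℕ} {v v' : Fin l → Fin (2 * l + 1) → ℂ} {w w' : Fin l → Fin (2 * l + 1)}
  {S S' : Finset (Fin l)}

theorem isIsotropic (h : NormalForm v w S) : IsIsotropic v :=
  ⟨linearIndependent_of_hasPivot h.hasPivot h.injective, h.beta_eq_zero⟩

theorem admissible (h : NormalForm v w S) : Admissible w := by
  refine ⟨h.injective, fun i j e => ?_⟩
  refine HasPivot.beta_ne_zero (h.hasPivot j) (y := v i) (r := w j) ?_ (h.beta_eq_zero j i)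
  rw [← e]
  exact h.hasPivot i

theorem mid_lt (h : NormalForm v w S) {i : Fin l} (hi : i ∈ S) : mid l < w i := by
  have h1 := h.beta_e0 i
  rw [if_pos hi, beta_e0_right] at h1
  by_contra h2
  rw [(h.hasPivot i).2 _ (lt_of_le_of_ne (not_lt.1 h2) (h.admissible.ne_mid i))] at h1
  exact zero_ne_one h1

/-- The normalized sequence is part of a Witt basis adapted to the standard flag and to `e0`. -/
theorem exists_borel (h : NormalForm v w S) :
    ∃ g ∈ borelSubgroup (2 * l + 1),
      g.1.1 *ᵥ (Pi.single (mid l) 1 + ∑ i ∈ S, Pi.single (w i).rev 1) = e0 l ∧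
      ∀ i, g.1.1 *ᵥ Pi.single (w i) 1 = v i := by
  classical
  have hw := h.admissible
  -- `A` is the pairing of the `v j` with the `e_{(w k).rev}`. It is triangular for the order of
  -- pivots, and it is invertible because a nontrivial combination of the `v j` is nonzero at its
  -- own pivot, which is some `w i`.
  let A : Matrix (Fin l) (Fin l) ℂ := Matrix.of fun k j => v j (w k)
  have hAt : A.BlockTriangular w := fun k j hkj => (h.hasPivot j).2 _ hkj
  have hAu : IsUnit A := by
    rw [← Matrix.mulVec_injective_iff_isUnit]
    intro c c' hcc
    rw [← sub_eq_zero]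
    by_contra hne
    have hz : A *ᵥ (c - c') = 0 := by rw [Matrix.mulVec_sub, hcc, sub_self]
    obtain ⟨i, -, hp, -⟩ := exists_hasPivot_sum h.hasPivot hw.1 hne
    refine hp.1 ?_
    have := congrFun hz i
    simpa [A, Matrix.mulVec, dotProduct, mul_comm] using this
  have hAi : A⁻¹ * A = 1 := Matrix.nonsing_inv_mul A ((Matrix.isUnit_iff_isUnit_det A).1 hAu)
  have hAit : A⁻¹.BlockTriangular w := by
    have := hAu.invertible
    exact Matrix.blockTriangular_inv_of_blockTriangular hAt
  -- The family dual to `v` inside the isotropic span of the `e_{(w k).rev}`. Triangularity of `A⁻¹`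
  -- gives `z i` no coordinates beyond `(w i).rev`, which makes the final matrix upper triangular.
  let z : Fin l → Fin (2 * l + 1) → ℂ := fun i => ∑ k, A⁻¹ i k • Pi.single (w k).rev 1
  -- The correction makes `y` orthogonal to every `v i`, since `beta (v i) (e0 l)` is the indicator
  -- of `S`. It involves only indices below the middle, because `w i` lies above the middle for `i ∈
  -- S`.
  let y : Fin (2 * l + 1) → ℂ := e0 l - ∑ i ∈ S, z i
  have hzv : ∀ i j, beta (v j) (z i) = if j = i then 1 else 0 := by
    intro i j
    have := congrFun (congrFun hAi i) j
    rw [Matrix.mul_apply, Matrix.one_apply] at this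
    simp only [z, beta_sum_right, beta_smul_right, beta_single_right, Fin.rev_rev]
    refine Eq.trans ?_ (this.trans ?_)
    · rfl
    · rcases eq_or_ne i j with rfl | hij
      · simp
      · rw [if_neg hij, if_neg hij.symm]
  have hzz : ∀ i j, beta (z i) (z j) = 0 := by
    intro i j
    simp only [z, beta_sum_right, beta_smul_right, beta_single_right, Fin.rev_rev,
      Finset.sum_apply, Pi.smul_apply, smul_eq_mul, Pi.single_apply, hw.2, if_false, mul_zero,
      Finset.sum_const_zero]
  have hz0 : ∀ i, z i (mid l) = 0 := by
    intro i
    simp [z, Finset.sum_apply, (hw.rev_ne_mid _).symm]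
  have hze : ∀ i, beta (z i) (e0 l) = 0 := fun i => by rw [beta_e0_right, hz0]
  have hey : beta (e0 l) (e0 l) = 1 := by rw [beta_e0_right, e0_eq_single, Pi.single_eq_same]
  have hW : IsWittBasis v z y := by
    refine ⟨h.beta_eq_zero, hzz, fun i j => hzv j i, fun i => ?_, fun i => ?_, ?_⟩
    · simp only [y, beta_sub_right, h.beta_e0, beta_sum_right, hzv]
      simp
    · simp only [y, beta_sub_right, beta_sum_right, hze, hzz]
      simp
    · have h1 : ∀ i, beta (e0 l) (z i) = 0 := fun i => by rw [beta_comm, hze]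
      simp only [y, beta_sub_right, beta_sub_left, beta_sum_right, beta_sum_left, hze, hzz, h1, hey]
      simp
  have hzt : ∀ i r, (w i).rev < r → z i r = 0 := by
    intro i r hr
    simp only [z, Finset.sum_apply, Pi.smul_apply, smul_eq_mul]
    refine Finset.sum_eq_zero fun k _ => ?_
    by_cases hk : r = (w k).rev
    · rw [hAit (show w k < w i from ?_), zero_mul]
      rw [hk] at hr
      exact Fin.rev_lt_rev.1 hr
    · rw [Pi.single_eq_of_ne hk, mul_zero]
  have hyt : ∀ r, mid l < r → y r = 0 := by
    intro r hr
    simp only [y, e0_eq_single, Pi.sub_apply, Pi.single_eq_of_ne hr.ne', Finset.sum_apply, zero_sub,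
      neg_eq_zero]
    refine Finset.sum_eq_zero fun i hi => hzt i r (lt_trans ?_ hr)
    rw [← mid_rev, Fin.rev_lt_rev]
    exact h.mid_lt hi
  have hy0 : y (mid l) = 1 := by
    simp [y, hz0, e0_eq_single]
  let Y := LinearMap.toMatrix' (wittMap w v z y)
  have hYr : ∀ i j, Y i j = wittMap w v z y (Pi.single j 1) i := fun i j => by
    rw [← LinearMap.toMatrix'_mulVec, Matrix.mulVec_single_one]
    rfl
  have hYt : Y.BlockTriangular id := by
    intro r s hrs
    rw [hYr]
    rcases hw.cases s with ⟨j, rfl⟩ | ⟨j, rfl⟩ | rfl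
    · rw [wittMap_single hw]
      exact (h.hasPivot j).2 _ hrs
    · rw [wittMap_single_rev hw]
      exact hzt j r hrs
    · rw [wittMap_single_mid hw]
      exact hyt r hrs
  have hYb : ∀ a b, beta (Y *ᵥ a) (Y *ᵥ b) = beta a b := fun a b => by
    simp only [Y, LinearMap.toMatrix'_mulVec, beta_wittMap hw hW]
  have hYd : Y.det = 1 := det_eq_one_of_blockTriangular hYb hYt (by
    rw [hYr, wittMap_single_mid hw, hy0])
  refine ⟨⟨⟨Y, hYd⟩, hYb⟩, hYt, ?_, fun i => ?_⟩
  · simp only [Y, LinearMap.toMatrix'_mulVec, map_add, map_sum, wittMap_single_mid hw,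
      wittMap_single_rev hw]
    simp [y]
  · simp only [Y, LinearMap.toMatrix'_mulVec, wittMap_single hw]

/-- Normalized sequences with the same invariants are conjugate under the Borel subgroup of
`SO(2ℓ)`. -/
theorem exists_borelSOEven (h : NormalForm v w S) (h' : NormalForm v' w S) :
    ∃ k ∈ borelSOEven l, ∀ i, k.1.1 *ᵥ v i = v' i := by
  obtain ⟨g, hg, hg0, hgv⟩ := h.exists_borel
  obtain ⟨g', hg', hg0', hgv'⟩ := h'.exists_borel
  have hm : ∀ x, (g' * g⁻¹).1.1 *ᵥ x = g'.1.1 *ᵥ (g⁻¹.1.1 *ᵥ x) := by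
    intro x
    rw [Matrix.mulVec_mulVec]
    rfl
  -- Both `g` and `g'` send the same vector, built from `w` and `S` alone, to `e0`; hence `g' * g⁻¹`
  -- fixes `e0`.
  refine ⟨g' * g⁻¹, ⟨?_, (borelSubgroup _).mul_mem hg' ((borelSubgroup _).inv_mem hg)⟩, fun i => ?_⟩
  · change (g' * g⁻¹).1.1 *ᵥ e0 l = e0 l
    rw [hm]
    conv_lhs => rw [← hg0]
    rw [SO_inv_mulVec, hg0']
  · rw [hm, ← hgv, SO_inv_mulVec, hgv']

/-- An invertible upper triangular matrix preserves pivots, and an isometry fixing `e0` preserves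
the pairing with `e0`. -/
theorem map_borelSOEven (h : NormalForm v w S) {k : SO (2 * l + 1)} (hk : k ∈ borelSOEven l) :
    NormalForm (fun i => k.1.1 *ᵥ v i) w S := by
  have hk0 : k.1.1 *ᵥ e0 l = e0 l := hk.1
  have hkt : k.1.1.BlockTriangular id := hk.2
  refine ⟨fun i => ⟨?_, fun s hs => ?_⟩, h.injective, fun i j => ?_, fun i => ?_, h.lt_of_lt⟩
  · have hd : k.1.1 (w i) (w i) ≠ 0 := by
      have h1 := k.1.2
      rw [Matrix.det_of_isUpperTriangular hkt] at h1
      intro h2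
      exact zero_ne_one ((Finset.prod_eq_zero (f := fun j => k.1.1 j j) (Finset.mem_univ (w i))
        h2).symm.trans h1)
    rw [Matrix.mulVec, dotProduct, Finset.sum_eq_single (w i)]
    · exact mul_ne_zero hd (h.hasPivot i).1
    · intro r _ hr
      rcases lt_or_gt_of_ne hr with hr | hr
      · rw [hkt hr, zero_mul]
      · rw [(h.hasPivot i).2 _ hr, mul_zero]
    · simp
  · rw [Matrix.mulVec, dotProduct]
    refine Finset.sum_eq_zero fun r _ => ?_
    rcases le_or_gt s r with hr | hr
    · rw [(h.hasPivot i).2 _ (hs.trans_le hr), mul_zero]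
    · rw [hkt hr, zero_mul]
  · rw [k.2, h.beta_eq_zero]
  · conv_lhs => rw [← hk0]
    rw [k.2, h.beta_e0]

/-- Expand `v' i` in the `v j` with `j ≤ i`. Its pivot is some `w m` with `m ≤ i`, and injectivity
of `w'` with induction forces `m = i`. If `i ∈ S'`, its nonzero `e0`-coordinate must come from a
term with `j ∈ S`, whose pivot is at most that of the sum. -/
theorem index_eq_and_exists (h : NormalForm v w S) (h' : NormalForm v' w' S')
    (hf : ∀ i, v' i ∈ flagSpan v i) :
    w' = w ∧ ∀ i ∈ S', ∃ j ∈ S, j ≤ i ∧ w j ≤ w i := by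
  have key : ∀ i, ∃ c : Fin l → ℂ, (∀ j, c j ≠ 0 → j ≤ i) ∧ v' i = ∑ j, c j • v j ∧
      ∃ m ≤ i, w' i = w m ∧ ∀ j, c j ≠ 0 → w j ≤ w m := by
    intro i
    obtain ⟨c, hc, hs⟩ := mem_flagSpan_iff.1 (hf i)
    have hc0 : c ≠ 0 := by
      rintro rfl
      exact (h'.hasPivot i).ne_zero (by simp [hs])
    obtain ⟨m, hm, hp, hmax⟩ := exists_hasPivot_sum h.hasPivot h.injective hc0
    rw [← hs] at hp
    exact ⟨c, hc, hs, m, hc m hm, (h'.hasPivot i).unique hp, hmax⟩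
  have hw : ∀ i, w' i = w i := by
    intro i
    induction i using WellFoundedLT.induction with
    | ind i ih =>
      obtain ⟨-, -, -, m, hm, hwm, -⟩ := key i
      rcases hm.lt_or_eq with hlt | rfl
      · rw [← ih m hlt] at hwm
        exact absurd (h'.injective hwm).symm hlt.ne
      · exact hwm
  refine ⟨funext hw, fun i hi => ?_⟩
  obtain ⟨c, hc, hs, m, hm, hwm, hmax⟩ := key i
  have h1 := h'.beta_e0 i
  rw [if_pos hi, hs, beta_sum_left] at h1
  obtain ⟨j, -, hj⟩ := Finset.exists_ne_zero_of_sum_ne_zero (h1.trans_ne one_ne_zero)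
  rw [beta_smul_left, h.beta_e0] at hj
  have hcj : c j ≠ 0 := left_ne_zero_of_mul hj
  refine ⟨j, by_contra fun hjS => hj (by simp [hjS]), hc j hcj, ?_⟩
  rw [← hw i, hwm]
  exact hmax j hcj

/-- The invariants of a normalized sequence depend on its flag only. -/
theorem eq_of_flagSpan_eq (h : NormalForm v w S) (h' : NormalForm v' w' S')
    (hf : flagSpan v = flagSpan v') : w = w' ∧ S = S' := by
  obtain ⟨hw, hS⟩ := h.index_eq_and_exists h' fun i => by rw [hf]; exact mem_flagSpan _ le_rfl
  obtain ⟨-, hS'⟩ := h'.index_eq_and_exists h fun i => by rw [← hf]; exact mem_flagSpan _ le_rfl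
  subst hw
  -- Both sets are antichains for the order comparing index and pivot simultaneously, and each
  -- element of one dominates an element of the other. Going back and forth then returns to the
  -- starting element, so the sets agree.
  have anti : ∀ {T : Finset (Fin l)}, (∀ i ∈ T, ∀ j ∈ T, i < j → w' j < w' i) →
      ∀ {i k}, i ∈ T → k ∈ T → k ≤ i → w' k ≤ w' i → k = i := by
    intro T hT i k hi hk hki hwki
    rcases hki.lt_or_eq with hlt | rfl
    · exact absurd (hT k hk i hi hlt) (not_lt.2 hwki)
    · rfl
  refine ⟨rfl, Finset.ext fun i => ⟨fun hi => ?_, fun hi => ?_⟩⟩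
  · obtain ⟨j, hj, hji, hwj⟩ := hS' i hi
    obtain ⟨k, hk, hkj, hwk⟩ := hS j hj
    have := anti h.lt_of_lt hi hk (hkj.trans hji) (hwk.trans hwj)
    subst this
    rwa [le_antisymm hkj hji]
  · obtain ⟨j, hj, hji, hwj⟩ := hS i hi
    obtain ⟨k, hk, hkj, hwk⟩ := hS' j hj
    have := anti h'.lt_of_lt hi hk (hkj.trans hji) (hwk.trans hwj)
    subst this
    rwa [le_antisymm hkj hji]

/-- All possible invariants occur. -/
theorem exists_of_admissible (hw : Admissible w) (hS : ∀ i ∈ S, mid l < w i)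
    (hlt : ∀ i ∈ S, ∀ j ∈ S, i < j → w j < w i) : ∃ v, NormalForm v w S := by
  classical
  let ε : Fin l → ℂ := fun i => if i ∈ S then 1 else 0
  let s : Fin (2 * l + 1) → ℂ := ∑ j ∈ S, Pi.single (w j).rev 1
  have hsr : ∀ r, mid l ≤ r → s r = 0 := by
    intro r hr
    simp only [s, Finset.sum_apply]
    refine Finset.sum_eq_zero fun j hj => Pi.single_eq_of_ne (ne_of_gt (lt_of_lt_of_le ?_ hr)) _
    rw [← mid_rev, Fin.rev_lt_rev]
    exact hS j hj
  have hss : beta s s = 0 := by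
    simp only [s, beta_sum_right, beta_single_right, Fin.rev_rev, Finset.sum_apply,
      Pi.single_apply, hw.2, if_false, Finset.sum_const_zero]
  have hws : ∀ i, beta (Pi.single (w i) 1) s = ε i := by
    intro i
    simp [s, beta_sum_right, beta_single_right, Pi.single_apply, hw.1.eq_iff, ε]
  have hes : beta (e0 l) s = 0 := by rw [beta_comm, beta_e0_right, hsr _ le_rfl]
  have hew : ∀ i, beta (e0 l) (Pi.single (w i) 1) = 0 := fun i => by
    rw [beta_comm, beta_e0_right, Pi.single_eq_of_ne (hw.ne_mid i).symm]
  have hww : ∀ i j, beta (Pi.single (w i) 1) (Pi.single (w j) 1 : Fin (2 * l + 1) → ℂ) = 0 :=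
    fun i j => by rw [beta_single_right, Pi.single_eq_of_ne (hw.2 i j).symm]
  have hee : beta (e0 l) (e0 l) = 1 := by rw [beta_e0_right, e0_eq_single, Pi.single_eq_same]
  have hsw : ∀ i, beta s (Pi.single (w i) 1) = ε i := fun i => by rw [beta_comm, hws]
  have hwe : ∀ i, beta (Pi.single (w i) 1) (e0 l) = 0 := fun i => by rw [beta_comm, hew]
  have hse : beta s (e0 l) = 0 := by rw [beta_comm, hes]
  -- Adding `e0` alone would give pairings `ε i * ε j`. Since `s` is isotropic, orthogonal to `e0`
  -- and pairs with `e_{w i}` to `ε i`, the two cross terms with `-s / 2` cancel this; `s` lives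
  -- below the middle, so the pivots do not change.
  refine ⟨fun i => Pi.single (w i) 1 + ε i • (e0 l - (1 / 2 : ℂ) • s), fun i => ⟨?_, fun r hr => ?_⟩,
    hw.1, fun i j => ?_, fun i => ?_, hlt⟩
  · by_cases hi : i ∈ S
    · simp [hsr _ (hS i hi).le, e0_eq_single, hw.ne_mid i]
    · simp [ε, hi]
  · by_cases hi : i ∈ S
    · have h1 := (hS i hi).trans hr
      simp [hsr _ h1.le, e0_eq_single, h1.ne', hr.ne']
    · simp [ε, hi, hr.ne']
  · simp only [beta_add_left, beta_add_right, beta_sub_left, beta_sub_right, beta_smul_left,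
      beta_smul_right, hww, hws, hew, hee, hes, hss, hse, hwe, hsw]
    ring
  · simp only [beta_add_left, beta_sub_left, beta_smul_left, hwe, hee, hse]
    simp [ε]

end NormalForm

/-- Every sequence of independent vectors can be changed into one with distinct pivots that spans
the same flag. -/
theorem exists_hasPivot_mem_flagSpan {n k : ℕ} {v : Fin k → Fin n → ℂ}
    (hv : LinearIndependent ℂ v) : ∃ (v' : Fin k → Fin n → ℂ) (w : Fin k → Fin n),
      (∀ i, HasPivot (v' i) (w i)) ∧ Function.Injective w ∧ ∀ i, v' i ∈ flagSpan v i := by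
  have hne : ∀ i, ∀ x ∈ Submodule.span ℂ (v '' Set.Iio i), v i + x ≠ 0 := by
    intro i x hx h0
    refine hv.notMem_span_image (s := Set.Iio i) (x := i) (by simp) ?_
    rw [eq_neg_of_add_eq_zero_left h0]
    exact neg_mem hx
  -- Each vector is reduced by its predecessors to the smallest possible pivot. Two equal pivots
  -- would allow a further cancellation in the later vector, contradicting minimality.
  have hmin : ∀ i, ∃ r, (∃ x ∈ Submodule.span ℂ (v '' Set.Iio i), HasPivot (v i + x) r) ∧
      ∀ x ∈ Submodule.span ℂ (v '' Set.Iio i), ∀ s, HasPivot (v i + x) s → r ≤ s := by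
    intro i
    obtain ⟨r₀, hr₀⟩ := exists_hasPivot (hne i 0 (zero_mem _))
    obtain ⟨r, hr, hm⟩ := WellFounded.has_min (wellFounded_lt (α := Fin n))
      {r | ∃ x ∈ Submodule.span ℂ (v '' Set.Iio i), HasPivot (v i + x) r}
      ⟨r₀, 0, zero_mem _, hr₀⟩
    exact ⟨r, hr, fun x hx s hs => not_lt.1 (hm s ⟨x, hx, hs⟩)⟩
  choose w hw hmin using hmin
  choose x hx hp using hw
  have hlt : ∀ i j, i < j → w i ≠ w j := by
    intro i j hij hw
    have hmono : Submodule.span ℂ (v '' Set.Iio i) ≤ Submodule.span ℂ (v '' Set.Iio j) :=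
      Submodule.span_mono (Set.image_mono (Set.Iio_subset_Iio hij.le))
    set c := (v j + x j) (w j) / (v i + x i) (w j) with hc
    have hc0 : (v i + x i) (w j) ≠ 0 := hw ▸ (hp i).1
    have hmem : x j - c • (v i + x i) ∈ Submodule.span ℂ (v '' Set.Iio j) :=
      sub_mem (hx j) (Submodule.smul_mem _ _ (add_mem (Submodule.subset_span ⟨i, hij, rfl⟩)
        (hmono (hx i))))
    obtain ⟨r, hr⟩ := exists_hasPivot (hne j _ hmem)
    have hr0 := hr.1
    have e : v j + (x j - c • (v i + x i)) = (v j + x j) - c • (v i + x i) := by abel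
    rw [e, Pi.sub_apply, Pi.smul_apply, smul_eq_mul] at hr0
    refine hr0 ?_
    rcases (hmin j _ hmem r hr).eq_or_lt with rfl | hlt
    · rw [hc, div_mul_cancel₀ _ hc0, sub_self]
    · rw [(hp j).2 r hlt, (hp i).2 r (hw ▸ hlt), mul_zero, sub_zero]
  refine ⟨fun i => v i + x i, w, hp, fun i j hij => ?_, fun i => ?_⟩
  · rcases lt_trichotomy i j with h | h | h
    · exact absurd hij (hlt i j h)
    · exact h
    · exact absurd hij.symm (hlt j i h)
  · exact add_mem (mem_flagSpan v le_rfl)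
      (Submodule.span_mono (Set.image_mono Set.Iio_subset_Iic_self) (hx i))

theorem IsIsotropic.exists_normalForm {l : ℕ} {v : Fin l → Fin (2 * l + 1) → ℂ}
    (hv : IsIsotropic v) : ∃ v' w S, NormalForm v' w S ∧ flagSpan v' = flagSpan v := by
  classical
  obtain ⟨u, w, hp, hw, hu⟩ := exists_hasPivot_mem_flagSpan hv.linearIndependent
  -- `C i j` says that `u j` can clear the `e0`-coordinate of `u i` without changing its pivot or
  -- leaving its flag step.
  let C : Fin l → Fin l → Prop := fun i j => j < i ∧ w j < w i ∧ beta (u j) (e0 l) ≠ 0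
  let S : Finset (Fin l) := Finset.univ.filter fun i => (¬ ∃ j, C i j) ∧ beta (u i) (e0 l) ≠ 0
  have key : ∀ i, ∃ y, HasPivot y (w i) ∧ y ∈ flagSpan v i ∧
      beta y (e0 l) = if i ∈ S then 1 else 0 := by
    intro i
    by_cases h : ∃ j, C i j
    · obtain ⟨j, hji, hwj, hj⟩ := id h
      refine ⟨u i + (-(beta (u i) (e0 l) / beta (u j) (e0 l))) • u j, ⟨?_, fun r hr => ?_⟩, ?_, ?_⟩
      · simpa [(hp j).2 _ hwj] using (hp i).1
      · simp [(hp j).2 _ (hwj.trans hr), (hp i).2 _ hr]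
      · exact add_mem (hu i) (Submodule.smul_mem _ _ (flagSpan_mono v hji.le (hu j)))
      · rw [beta_add_left, beta_smul_left, if_neg (by simp [S, h])]
        field_simp
        ring
    · by_cases h0 : beta (u i) (e0 l) = 0
      · exact ⟨u i, hp i, hu i, by simp [S, h0]⟩
      · refine ⟨(beta (u i) (e0 l))⁻¹ • u i, (hp i).smul (inv_ne_zero h0),
          Submodule.smul_mem _ _ (hu i), ?_⟩
        have hi : i ∈ S := by simp only [S, Finset.mem_filter]; exact ⟨Finset.mem_univ _, h, h0⟩
        rw [beta_smul_left, if_pos hi, inv_mul_cancel₀ h0]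
  choose v' hp' hm' hb' using key
  refine ⟨v', w, S, ⟨hp', hw, fun i j => hv.beta_flagSpan (hm' i) (hm' j), hb', ?_⟩,
    flagSpan_eq_of_mem hv.linearIndependent (linearIndependent_of_hasPivot hp' hw) hm'⟩
  intro i hi j hj hij
  simp only [S, Finset.mem_filter] at hi hj
  by_contra hlt
  -- If `w` failed to decrease from `i` to `j`, then `u i` could clear `u j`, so `j` would not be in
  -- `S`.
  exact hj.2.1 ⟨i, hij, lt_of_le_of_ne (not_lt.1 hlt) (fun e => hij.ne (hw e)), hi.2.2⟩

/-! ### Stabilizers of isotropic flags -/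

/-- The subalgebra of `𝔰𝔬(n)` that stabilizes the flag spanned by `v`. -/
def stab {n k : ℕ} (v : Fin k → Fin n → ℂ) : LieSubalgebra ℂ (so n) where
  carrier := {X | ∀ i, ∀ x ∈ flagSpan v i, X.1 *ᵥ x ∈ flagSpan v i}
  add_mem' := by
    intro X Y hX hY i x hx
    change (X.1 + Y.1) *ᵥ x ∈ _
    rw [Matrix.add_mulVec]
    exact add_mem (hX i x hx) (hY i x hx)
  zero_mem' := by
    intro i x _
    change (0 : Matrix (Fin n) (Fin n) ℂ) *ᵥ x ∈ _
    rw [Matrix.zero_mulVec]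
    exact zero_mem _
  smul_mem' := by
    intro c X hX i x hx
    change (c • X.1) *ᵥ x ∈ _
    rw [Matrix.smul_mulVec]
    exact Submodule.smul_mem _ _ (hX i x hx)
  lie_mem' := by
    intro X Y hX hY i x hx
    change (X.1 * Y.1 - Y.1 * X.1) *ᵥ x ∈ _
    rw [Matrix.sub_mulVec, ← Matrix.mulVec_mulVec, ← Matrix.mulVec_mulVec]
    exact sub_mem (hX i _ (hY i x hx)) (hY i _ (hX i x hx))

theorem mem_stab {n k : ℕ} {v : Fin k → Fin n → ℂ} {X : so n} :
    X ∈ stab v ↔ ∀ i, ∀ x ∈ flagSpan v i, X.1 *ᵥ x ∈ flagSpan v i := Iff.rfl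

theorem mem_stab_of_forall {n k : ℕ} {v : Fin k → Fin n → ℂ} {X : so n}
    (h : ∀ i, X.1 *ᵥ v i ∈ flagSpan v i) : X ∈ stab v := by
  intro i x hx
  have h1 : flagSpan v i ≤ (flagSpan v i).comap (Matrix.toLin' X.1) := by
    rw [flagSpan_le_iff]
    intro j hj
    simpa using flagSpan_mono v hj (h j)
  simpa using h1 hx

theorem stab_congr {n k : ℕ} {v v' : Fin k → Fin n → ℂ} (h : flagSpan v = flagSpan v') :
    stab v = stab v' := by
  ext X
  rw [mem_stab, mem_stab, h]

/-- The translate of a sequence of vectors by an element of `SO(n)`. -/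
def translate {n k : ℕ} (g : SO n) (v : Fin k → Fin n → ℂ) : Fin k → Fin n → ℂ :=
  fun i => g.1.1 *ᵥ v i

theorem translate_translate_inv {n k : ℕ} (g : SO n) (v : Fin k → Fin n → ℂ) :
    translate g (translate g⁻¹ v) = v := funext fun i => SO_mulVec_inv g (v i)

theorem translate_inv_translate {n k : ℕ} (g : SO n) (v : Fin k → Fin n → ℂ) :
    translate g⁻¹ (translate g v) = v := funext fun i => SO_inv_mulVec g (v i)

theorem flagSpan_translate {n k : ℕ} (g : SO n) (v : Fin k → Fin n → ℂ) (i : Fin k) :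
    flagSpan (translate g v) i = (flagSpan v i).map (Matrix.toLin' g.1.1) := by
  rw [flagSpan, flagSpan, Submodule.map_span, ← Set.image_comp]
  rfl

theorem mem_flagSpan_translate {n k : ℕ} {g : SO n} {v : Fin k → Fin n → ℂ} {i : Fin k}
    {x : Fin n → ℂ} : x ∈ flagSpan (translate g v) i ↔ g⁻¹.1.1 *ᵥ x ∈ flagSpan v i := by
  rw [flagSpan_translate, Submodule.mem_map]
  constructor
  · rintro ⟨y, hy, rfl⟩
    rwa [Matrix.toLin'_apply, SO_inv_mulVec]
  · exact fun h => ⟨_, h, by rw [Matrix.toLin'_apply, SO_mulVec_inv]⟩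

theorem flagSpan_translate_congr {n k : ℕ} (g : SO n) {v v' : Fin k → Fin n → ℂ}
    (h : flagSpan v = flagSpan v') : flagSpan (translate g v) = flagSpan (translate g v') := by
  funext i
  rw [flagSpan_translate, flagSpan_translate, h]

theorem IsIsotropic.isIsotropic_translate {n k : ℕ} {v : Fin k → Fin n → ℂ} (hv : IsIsotropic v)
    (g : SO n) :
    IsIsotropic (translate g v) := by
  refine ⟨?_, fun i j => ?_⟩
  · refine hv.linearIndependent.map' (Matrix.toLin' g.1.1) ?_
    rw [LinearMap.ker_eq_bot]
    intro x y h
    rw [← SO_inv_mulVec g x, ← SO_inv_mulVec g y]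
    simp only [Matrix.toLin'_apply] at h
    rw [h]
  · exact (g.2 _ _).trans (hv.beta_eq_zero i j)

theorem Ad_mulVec {n : ℕ} (g : SO n) (X : so n) (x : Fin n → ℂ) :
    (Ad g X).1 *ᵥ x = g.1.1 *ᵥ (X.1 *ᵥ (g⁻¹.1.1 *ᵥ x)) := by
  change (g.1.1 * X.1 * g.1⁻¹.1) *ᵥ x = _
  rw [← Matrix.mulVec_mulVec, ← Matrix.mulVec_mulVec]
  rfl

theorem Ad_mem_stab_translate {n k : ℕ} {g : SO n} {v : Fin k → Fin n → ℂ} {X : so n}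
    (hX : X ∈ stab v) : Ad g X ∈ stab (translate g v) := by
  intro i x hx
  rw [mem_flagSpan_translate] at hx ⊢
  rw [Ad_mulVec, SO_inv_mulVec]
  exact hX i _ hx

theorem stab_translate {n k : ℕ} (g : SO n) (v : Fin k → Fin n → ℂ) :
    stab (translate g v) = (stab v).map (Ad g) := by
  ext X
  rw [LieSubalgebra.mem_map]
  constructor
  · intro hX
    refine ⟨Ad g⁻¹ X, ?_, ?_⟩
    · have := Ad_mem_stab_translate (g := g⁻¹) hX
      rwa [translate_inv_translate] at this
    · rw [← Ad_mul, mul_inv_cancel, Ad_one]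
  · rintro ⟨Y, hY, rfl⟩
    exact Ad_mem_stab_translate hY

/-! ### The standard flag -/

/-- The standard isotropic sequence `e_1, …, e_ℓ`. -/
def stdFlag (l : ℕ) : Fin l → Fin (2 * l + 1) → ℂ := fun i => Pi.single (stdIndex i) 1

theorem isIsotropic_stdFlag (l : ℕ) : IsIsotropic (stdFlag l) := by
  refine ⟨linearIndependent_of_hasPivot (w := stdIndex) (fun i => ⟨?_, fun s hs => ?_⟩)
    (admissible_stdIndex l).1, fun i j => ?_⟩
  · simp [stdFlag]
  · simp [stdFlag, hs.ne']
  · rw [stdFlag, stdFlag, beta_single_right,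
      Pi.single_eq_of_ne ((admissible_stdIndex l).2 i j).symm]

theorem mem_flagSpan_stdFlag {l : ℕ} {i : Fin l} {x : Fin (2 * l + 1) → ℂ} :
    x ∈ flagSpan (stdFlag l) i ↔ ∀ s, stdIndex i < s → x s = 0 := by
  constructor
  · intro hx s hs
    obtain ⟨c, hc, rfl⟩ := mem_flagSpan_iff.1 hx
    rw [Finset.sum_apply]
    refine Finset.sum_eq_zero fun j _ => ?_
    by_cases hj : c j = 0
    · simp [hj]
    · have h1 : stdIndex j < s := lt_of_le_of_lt (by simpa [stdIndex] using hc j hj) hs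
      simp [stdFlag, h1.ne']
  · intro h
    rw [mem_flagSpan_iff]
    refine ⟨fun j => x (stdIndex j), fun j hj => ?_, ?_⟩
    · by_contra hij
      exact hj (h _ (by simpa [stdIndex] using hij))
    · ext r
      rw [Finset.sum_apply]
      by_cases hr : r.1 < l
      · rw [Finset.sum_eq_single ⟨r.1, hr⟩]
        · simp [stdFlag, stdIndex]
        · intro j _ hj
          have : r ≠ stdIndex j := fun e => hj (by simp [e, stdIndex])
          simp [stdFlag, this]
        · simp
      · rw [h r (by simp only [stdIndex, Fin.lt_def]; omega), eq_comm]
        refine Finset.sum_eq_zero fun j _ => ?_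
        have : r ≠ stdIndex j := fun e => hr (by simp [e, stdIndex])
        simp [stdFlag, this]

theorem mem_so_iff_apply {n : ℕ} {Z : Matrix (Fin n) (Fin n) ℂ} :
    Z ∈ so n ↔ ∀ i j, Z i j = - Z j.rev i.rev := by
  have h1 : ∀ i j, (Zᵀ * antidiag n) i j = Z j.rev i := fun i j => by
    simp [Matrix.mul_apply, antidiag, eq_comm (a := j), Fin.rev_eq_iff]
  have h2 : ∀ i j, (antidiag n * -Z) i j = - Z i.rev j := fun i j => by
    simp [Matrix.mul_apply, antidiag]
  rw [mem_skewAdjointMatricesLieSubalgebra, mem_skewAdjointMatricesSubmodule,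
    Matrix.IsSkewAdjoint, Matrix.IsAdjointPair]
  constructor
  · intro h i j
    rw [← Fin.rev_rev i, ← h1, h, h2, Fin.rev_rev]
  · intro h
    ext i j
    rw [h1, h2, h, Fin.rev_rev]

/-- Stability of the flag constrains only the first `l` columns; skewness reflects an entry below
the diagonal in any other column into one of these. -/
theorem mem_stab_stdFlag {l : ℕ} {X : so (2 * l + 1)} :
    X ∈ stab (stdFlag l) ↔ X.1.BlockTriangular id := by
  constructor
  · intro h
    have key : ∀ (i : Fin l) r, stdIndex i < r → X.1 r (stdIndex i) = 0 := by
      intro i r hr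
      have := mem_flagSpan_stdFlag.1 (h i _ (mem_flagSpan (stdFlag l) le_rfl)) r hr
      rwa [stdFlag, Matrix.mulVec_single_one] at this
    intro r s hrs
    change s < r at hrs
    by_cases hs : s.1 < l
    · exact key ⟨s.1, hs⟩ r hrs
    · rw [mem_so_iff_apply.1 X.2, neg_eq_zero]
      have hr : r.rev.1 < l := by
        rw [Fin.lt_def] at hrs
        rw [Fin.val_rev]
        omega
      exact key ⟨r.rev.1, hr⟩ s.rev (Fin.rev_lt_rev.2 hrs)
  · intro h i x hx
    rw [mem_flagSpan_stdFlag] at hx ⊢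
    intro s hs
    rw [Matrix.mulVec, dotProduct]
    refine Finset.sum_eq_zero fun r _ => ?_
    rcases le_or_gt s r with hr | hr
    · rw [hx _ (hs.trans_le hr), mul_zero]
    · rw [h hr, zero_mul]

/-- Witt's theorem for complete isotropic flags. The isometry from `exists_borel` supplies the dual
vectors and the unit vector; the Witt basis is then regrouped along the standard indices. -/
theorem IsIsotropic.exists_translate {l : ℕ} {v : Fin l → Fin (2 * l + 1) → ℂ}
    (hv : IsIsotropic v) : ∃ g, flagSpan v = flagSpan (translate g (stdFlag l)) := by
  obtain ⟨v', w, S, h, hf⟩ := hv.exists_normalForm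
  have hw := h.admissible
  obtain ⟨g, -, -, hg⟩ := h.exists_borel
  have hW : IsWittBasis v' (fun i => g.1.1 *ᵥ Pi.single (w i).rev 1)
      (g.1.1 *ᵥ Pi.single (mid l) 1) := by
    refine ⟨h.beta_eq_zero, fun i j => ?_, fun i j => ?_, fun i => ?_, fun i => ?_, ?_⟩
    · rw [g.2, beta_single_right, Fin.rev_rev, Pi.single_eq_of_ne (hw.2 j i)]
    · rw [← hg, g.2, beta_single_right, Fin.rev_rev, Pi.single_apply]
      simp [hw.1.eq_iff, eq_comm]
    · rw [← hg, g.2, beta_single_right, mid_rev, Pi.single_eq_of_ne (hw.ne_mid i).symm]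
    · rw [g.2, beta_single_right, mid_rev, Pi.single_eq_of_ne (hw.rev_ne_mid i).symm]
    · rw [g.2, beta_single_right, mid_rev, Pi.single_eq_same]
  obtain ⟨g', hg'⟩ := exists_mem_SO_of_isWittBasis hW
  refine ⟨g', ?_⟩
  rw [← hf]
  congr 1
  funext i
  exact (hg' i).symm

/-! ### Solvability -/

theorem isSolvable_of_filtration {L : Type*} [LieRing L] [LieAlgebra ℂ L]
    (K : ℕ → Submodule ℂ L) (h0 : K 0 = ⊤) (m : ℕ) (hm : K m = ⊥)
    (h : ∀ k, ∀ x ∈ K k, ∀ y ∈ K k, ⁅x, y⁆ ∈ K (k + 1)) : LieAlgebra.IsSolvable L := by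
  rw [LieAlgebra.isSolvable_iff ℂ]
  have key : ∀ k, (LieAlgebra.derivedSeries ℂ L k).toSubmodule ≤ K k := by
    intro k
    induction k with
    | zero => rw [h0]; exact le_top
    | succ k ih =>
      rw [LieAlgebra.derivedSeries_def, LieAlgebra.derivedSeriesOfIdeal_succ,
        LieSubmodule.lieIdeal_oper_eq_linear_span', Submodule.span_le]
      rintro _ ⟨x, hx, y, hy, rfl⟩
      exact h k x (ih hx) y (ih hy)
  refine ⟨m, ?_⟩
  have := key m
  rw [hm, le_bot_iff] at this
  simpa using this

theorem isSolvable_stab_stdFlag (l : ℕ) : LieAlgebra.IsSolvable (stab (stdFlag l)) := by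
  let K : ℕ → Submodule ℂ (stab (stdFlag l)) := fun k =>
    { carrier := {X | ∀ i j : Fin (2 * l + 1), j.1 < i.1 + k → X.1.1 i j = 0}
      add_mem' := by
        intro X Y hX hY i j hij
        change X.1.1 i j + Y.1.1 i j = 0
        rw [hX i j hij, hY i j hij, add_zero]
      zero_mem' := fun i j _ => rfl
      smul_mem' := by
        intro c X hX i j hij
        change c • X.1.1 i j = 0
        rw [hX i j hij, smul_zero] }
  have hK0 : ∀ X, X ∈ K 0 := by
    intro X i j hij
    exact mem_stab_stdFlag.1 X.2 (show j < i from hij)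
  -- A product of two elements of `K k` already satisfies the vanishing conditions of `K (k + 1)`,
  -- except on the diagonal for `k = 0`. There the entry is a product of scalars, which cancels in
  -- the commutator.
  have hprod : ∀ k, ∀ X ∈ K k, ∀ Y ∈ K k, ∀ i j : Fin (2 * l + 1), j.1 < i.1 + (k + 1) →
      (X.1.1 * Y.1.1) i j = if j.1 = i.1 + k ∧ k = 0 then X.1.1 i i * Y.1.1 i i else 0 := by
    intro k X hX Y hY i j hij
    rw [Matrix.mul_apply]
    split_ifs with h
    · obtain ⟨h1, rfl⟩ := h
      obtain rfl : j = i := Fin.ext h1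
      rw [Finset.sum_eq_single j]
      · intro r _ hr
        rcases lt_or_gt_of_ne hr with hr | hr
        · rw [hX j r hr, zero_mul]
        · rw [hY r j hr, mul_zero]
      · simp
    · refine Finset.sum_eq_zero fun r _ => ?_
      rcases lt_or_ge r.1 (i.1 + k) with hr | hr
      · rw [hX i r hr, zero_mul]
      · rw [hY r j (by omega), mul_zero]
  refine isSolvable_of_filtration K (eq_top_iff.2 fun X _ => hK0 X) (2 * l + 1) ?_ ?_
  · rw [eq_bot_iff]
    intro X hX
    rw [Submodule.mem_bot]
    refine Subtype.ext (Subtype.ext (Matrix.ext fun i j => ?_))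
    exact hX i j (by omega)
  · intro k X hX Y hY i j hij
    change (X.1.1 * Y.1.1 - Y.1.1 * X.1.1) i j = 0
    rw [Matrix.sub_apply, hprod k X hX Y hY i j hij, hprod k Y hY X hX i j hij, mul_comm (X.1.1 i i),
      sub_self]

theorem IsIsotropic.isSolvable_stab {l : ℕ} {v : Fin l → Fin (2 * l + 1) → ℂ}
    (hv : IsIsotropic v) : LieAlgebra.IsSolvable (stab v) := by
  obtain ⟨g, hg⟩ := hv.exists_translate
  rw [stab_congr hg, stab_translate]
  exact isSolvable_map g _ (isSolvable_stab_stdFlag l)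

/-! ### A flag is determined by its stabilizer -/

/-- A regular nilpotent element of `𝔰𝔬(2ℓ+1)`. -/
def regularNilpotent (l : ℕ) : Matrix (Fin (2 * l + 1)) (Fin (2 * l + 1)) ℂ :=
  Matrix.of fun i j => if j.1 = i.1 + 1 then (if i.1 < l then 1 else -1) else 0

theorem regularNilpotent_mem_so (l : ℕ) : regularNilpotent l ∈ so (2 * l + 1) := by
  rw [mem_so_iff_apply]
  intro i j
  simp only [regularNilpotent, Matrix.of_apply, Fin.val_rev]
  have := i.2
  have := j.2
  split_ifs <;> first | omega | simp

theorem flagSpan_eq_stdFlag_of_stab_le {l : ℕ} {v : Fin l → Fin (2 * l + 1) → ℂ}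
    (hv : IsIsotropic v) (h : stab (stdFlag l) ≤ stab v) : flagSpan v = flagSpan (stdFlag l) := by
  have hN : (⟨regularNilpotent l, regularNilpotent_mem_so l⟩ : so (2 * l + 1)) ∈ stab v := by
    refine h (mem_stab_stdFlag.2 fun i j hij => ?_)
    have : j.1 < i.1 := hij
    simp only [regularNilpotent, Matrix.of_apply]
    rw [if_neg (by omega)]
  have hNv : ∀ (x : Fin (2 * l + 1) → ℂ) (m m' : Fin (2 * l + 1)), m'.1 = m.1 + 1 →
      (regularNilpotent l *ᵥ x) m = (if m.1 < l then 1 else -1) * x m' := by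
    intro x m m' hm
    rw [Matrix.mulVec, dotProduct, Finset.sum_eq_single m']
    · simp [regularNilpotent, hm]
    · intro r _ hr
      have : r.1 ≠ m.1 + 1 := fun e => hr (Fin.ext (e.trans hm.symm))
      simp [regularNilpotent, this]
    · simp
  have hNtop : ∀ (x : Fin (2 * l + 1) → ℂ) (m : Fin (2 * l + 1)), (∀ s, m < s → x s = 0) →
      (regularNilpotent l *ᵥ x) m = 0 := by
    intro x m hx
    rw [Matrix.mulVec, dotProduct]
    refine Finset.sum_eq_zero fun r _ => ?_
    rcases le_or_gt r m with hr | hr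
    · have : r.1 ≠ m.1 + 1 := by
        have : r.1 ≤ m.1 := hr
        omega
      simp [regularNilpotent, this]
    · rw [hx r hr, mul_zero]
  refine flagSpan_eq_of_mem (isIsotropic_stdFlag l).linearIndependent hv.linearIndependent
    fun i => mem_flagSpan_stdFlag.2 ?_
  induction i using WellFoundedLT.induction with
  | ind i ih =>
    obtain ⟨c, hc, hs⟩ := mem_flagSpan_iff.1 (hN i _ (mem_flagSpan v le_rfl))
    -- By induction the earlier `v j` vanish at and beyond `stdIndex i`. If the pivot `m` of `v i`
    -- were larger, coordinate `m` would force `c i = 0`, while coordinate `m - 1` of the image is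
    -- `± v i m`, which is nonzero.
    have hcoord : ∀ m, stdIndex i ≤ m → (regularNilpotent l *ᵥ v i) m = c i * v i m := by
      intro m hm
      have h1 := congrFun hs m
      simp only at h1
      rw [h1, Finset.sum_apply, Finset.sum_eq_single i]
      · rfl
      · intro j _ hj
        by_cases hcj : c j = 0
        · simp [hcj]
        · have hji := lt_of_le_of_ne (hc j hcj) hj
          have : stdIndex j < stdIndex i := hji
          simp [ih j hji m (this.trans_le hm)]
      · simp
    obtain ⟨m, hm⟩ := exists_hasPivot (hv.linearIndependent.ne_zero i)
    suffices hmi : m ≤ stdIndex i from fun s hs => hm.2 s (hmi.trans_lt hs)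
    by_contra hlt
    rw [not_le] at hlt
    have hci : c i = 0 := by
      have h1 := hcoord m hlt.le
      rw [hNtop _ _ hm.2, eq_comm, mul_eq_zero] at h1
      exact h1.resolve_right hm.1
    have hpos : stdIndex i < m := hlt
    rw [Fin.lt_def] at hlt
    have hm' : m.1 = (⟨m.1 - 1, by omega⟩ : Fin (2 * l + 1)).1 + 1 := by
      simp only
      omega
    have h2 := hcoord ⟨m.1 - 1, by omega⟩ (by rw [Fin.le_def]; simp only; omega)
    rw [hNv _ _ m hm', hci, zero_mul, mul_eq_zero] at h2
    rcases h2 with h2 | h2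
    · split_ifs at h2 <;> norm_num at h2
    · exact hm.1 h2

theorem flagSpan_eq_of_stab_le {l : ℕ} {v v' : Fin l → Fin (2 * l + 1) → ℂ}
    (hv : IsIsotropic v) (hv' : IsIsotropic v') (h : stab v ≤ stab v') :
    flagSpan v = flagSpan v' := by
  obtain ⟨g, hg⟩ := hv.exists_translate
  have h1 : stab (stdFlag l) ≤ stab (translate g⁻¹ v') := by
    have h2 := map_mono g⁻¹ h
    rwa [← stab_translate, ← stab_translate,
      stab_congr (flagSpan_translate_congr g⁻¹ hg), translate_inv_translate] at h2
  have h3 := flagSpan_translate_congr g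
    (flagSpan_eq_stdFlag_of_stab_le (hv'.isIsotropic_translate g⁻¹) h1)
  rw [translate_translate_inv] at h3
  rw [hg, h3]

/-! ### Solvable subalgebras stabilize isotropic flags -/

/-- Lie's theorem for the subquotient `Q / P` of a Lie module. -/
theorem exists_eigenvector_mod {L V : Type*} [LieRing L] [LieAlgebra ℂ L]
    [LieAlgebra.IsSolvable L] [AddCommGroup V] [Module ℂ V] [Module.Finite ℂ V]
    [LieRingModule L V] [LieModule ℂ L V] {P Q : LieSubmodule ℂ L V} (h : ¬ Q ≤ P) :
    ∃ x ∈ Q, x ∉ P ∧ ∃ χ : L → ℂ, ∀ X : L, ⁅X, x⁆ - χ X • x ∈ P := by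
  -- The weight vector is sought in `Q / (P ∩ Q)`, which is nonzero because `Q` is not contained in
  -- `P`.
  let P' : LieSubmodule ℂ L Q := P.comap Q.incl
  obtain ⟨q, hqQ, hqP⟩ := SetLike.not_le_iff_exists.1 h
  have hmk : ∀ x : Q, LieSubmodule.Quotient.mk' P' x = 0 ↔ (x : V) ∈ P := fun x =>
    LieSubmodule.Quotient.mk_eq_zero P'
  have : Nontrivial (Q ⧸ P') :=
    ⟨LieSubmodule.Quotient.mk' P' ⟨q, hqQ⟩, 0, fun e => hqP ((hmk _).1 e)⟩
  obtain ⟨χ, hχ⟩ := LieModule.exists_nontrivial_weightSpace_of_isSolvable ℂ L (Q ⧸ P')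
  obtain ⟨⟨u, hu⟩, hu0⟩ := exists_ne (0 : LieModule.weightSpace (Q ⧸ P') χ)
  obtain ⟨x, rfl⟩ := LieSubmodule.Quotient.surjective_mk' P' u
  rw [LieModule.mem_weightSpace] at hu
  refine ⟨x, x.2, fun hx => hu0 (Subtype.ext ((hmk x).2 hx)), χ, fun X => ?_⟩
  have h1 := hu X
  rw [← LieModuleHom.map_lie, ← sub_eq_zero, ← map_smul, ← map_sub] at h1
  exact (hmk _).1 h1

/-- Lie's theorem for a solvable subalgebra of `𝔰𝔬(n)` and two stable subspaces. -/
theorem exists_eigenvector_mod_of_isSolvable {n : ℕ} {b : LieSubalgebra ℂ (so n)}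
    (hb : LieAlgebra.IsSolvable b) {P Q : Submodule ℂ (Fin n → ℂ)}
    (hP : ∀ X ∈ b, ∀ x ∈ P, X.1 *ᵥ x ∈ P) (hQ : ∀ X ∈ b, ∀ x ∈ Q, X.1 *ᵥ x ∈ Q)
    (h : ¬ Q ≤ P) :
    ∃ x ∈ Q, x ∉ P ∧ ∀ X ∈ b, ∃ c : ℂ, X.1 *ᵥ x - c • x ∈ P := by
  let _ : LieRingModule b (Fin n → ℂ) :=
    { bracket := fun X x => X.1.1 *ᵥ x
      add_lie := fun X Y x => Matrix.add_mulVec X.1.1 Y.1.1 x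
      lie_add := fun X x y => Matrix.mulVec_add X.1.1 x y
      leibniz_lie := fun X Y x => by
        change X.1.1 *ᵥ (Y.1.1 *ᵥ x) =
          (X.1.1 * Y.1.1 - Y.1.1 * X.1.1) *ᵥ x + Y.1.1 *ᵥ (X.1.1 *ᵥ x)
        rw [Matrix.sub_mulVec, ← Matrix.mulVec_mulVec, ← Matrix.mulVec_mulVec, sub_add_cancel] }
  have : LieModule ℂ b (Fin n → ℂ) :=
    { smul_lie := fun c X x => Matrix.smul_mulVec c X.1.1 x
      lie_smul := fun c X x => Matrix.mulVec_smul X.1.1 c x }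
  let P' : LieSubmodule ℂ b (Fin n → ℂ) := { P with lie_mem := fun {X x} hx => hP X.1 X.2 x hx }
  let Q' : LieSubmodule ℂ b (Fin n → ℂ) := { Q with lie_mem := fun {X x} hx => hQ X.1 X.2 x hx }
  obtain ⟨x, hxQ, hxP, χ, hχ⟩ := exists_eigenvector_mod (P := P') (Q := Q') h
  exact ⟨x, hxQ, hxP, fun X hX => ⟨χ ⟨X, hX⟩, hχ ⟨X, hX⟩⟩⟩

theorem so_beta {n : ℕ} (X : so n) (x y : Fin n → ℂ) : beta (X.1 *ᵥ x) y = - beta x (X.1 *ᵥ y) :=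
  (mem_so_iff X.1).1 X.2 x y

/-- The orthogonal complement of a finite family of vectors. -/
def orthogonal {n : ℕ} {ι : Type*} (u : ι → Fin n → ℂ) : Submodule ℂ (Fin n → ℂ) where
  carrier := {x | ∀ i, beta (u i) x = 0}
  add_mem' := by
    intro x y hx hy i
    rw [beta_add_right, hx i, hy i, add_zero]
  zero_mem' := by
    intro i
    simp [beta_eq_betaForm]
  smul_mem' := by
    intro c x hx i
    rw [beta_smul_right, hx i, mul_zero]

theorem not_orthogonal_le {n m k : ℕ} (u : Fin m → Fin n → ℂ) (v : Fin k → Fin n → ℂ)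
    (h : m + k < n) : ¬ orthogonal u ≤ Submodule.span ℂ (Set.range v) := by
  intro hle
  let f : (Fin n → ℂ) →ₗ[ℂ] Fin m → ℂ := LinearMap.pi fun i => betaForm n (u i)
  have h1 : LinearMap.ker f ≤ Submodule.span ℂ (Set.range v) := by
    intro x hx
    refine hle fun i => ?_
    rw [beta_eq_betaForm]
    exact congrFun hx i
  have h2 := Submodule.finrank_mono h1
  have h3 := LinearMap.finrank_range_add_finrank_ker f
  have h4 := Submodule.finrank_le (LinearMap.range f)
  have h5 := finrank_range_le_card (R := ℂ) v
  rw [Set.finrank] at h5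
  simp only [Module.finrank_fintype_fun_eq_card, Fintype.card_fin] at h3 h4 h5
  omega

/-- A stable isotropic subspace that is not maximal can be enlarged by a vector. -/
theorem exists_isotropic_extension {n k : ℕ} {b : LieSubalgebra ℂ (so n)}
    (hb : LieAlgebra.IsSolvable b) (hk : 2 * k + 1 < n) {v : Fin k → Fin n → ℂ}
    (hs : ∀ X ∈ b, ∀ x ∈ Submodule.span ℂ (Set.range v),
      X.1 *ᵥ x ∈ Submodule.span ℂ (Set.range v)) :
    ∃ x ∉ Submodule.span ℂ (Set.range v), (∀ i, beta (v i) x = 0) ∧ beta x x = 0 ∧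
      ∀ X ∈ b, ∃ c : ℂ, X.1 *ᵥ x - c • x ∈ Submodule.span ℂ (Set.range v) := by
  set P := Submodule.span ℂ (Set.range v) with hPdef
  have hP : ∀ x, (∀ i, beta (v i) x = 0) → ∀ y ∈ P, beta x y = 0 := by
    intro x hx y hy
    refine beta_mem_span_eq_zero ?_ hy
    rintro _ ⟨i, rfl⟩
    rw [beta_comm, hx]
  have hQ : ∀ X ∈ b, ∀ x ∈ orthogonal v, X.1 *ᵥ x ∈ orthogonal v := by
    intro X hX x hx i
    rw [beta_comm, so_beta, hP x hx _ (hs X hX _ (Submodule.subset_span ⟨i, rfl⟩)), neg_zero]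
  obtain ⟨x, hxQ, hxP, hx⟩ := exists_eigenvector_mod_of_isSolvable hb hs hQ
    (not_orthogonal_le v v (by omega))
  -- Skewness gives `beta x (X x) = 0`, so pairing the eigenvector relation with `x` shows that the
  -- eigenvalue on an anisotropic `x` is zero.
  have kill : ∀ x ∈ orthogonal v, beta x x ≠ 0 →
      (∀ X ∈ b, ∃ c : ℂ, X.1 *ᵥ x - c • x ∈ P) → ∀ X ∈ b, X.1 *ᵥ x ∈ P := by
    intro x hxQ hx0 hx X hX
    obtain ⟨c, hc⟩ := hx X hX
    have h1 := hP x hxQ _ hc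
    have h2 := so_beta X x x
    rw [beta_comm] at h2
    rw [beta_sub_right, beta_smul_right, self_eq_neg.1 h2, zero_sub, neg_eq_zero, mul_eq_zero] at h1
    rwa [h1.resolve_right hx0, zero_smul, sub_zero] at hc
  by_cases hxx : beta x x = 0
  · exact ⟨x, hxP, hxQ, hxx, hx⟩
  have hx' := kill x hxQ hxx hx
  have hQ' : ∀ X ∈ b, ∀ y ∈ orthogonal (Fin.snoc v x : Fin (k + 1) → Fin n → ℂ),
      X.1 *ᵥ y ∈ orthogonal (Fin.snoc v x : Fin (k + 1) → Fin n → ℂ) := by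
    intro X hX y hy
    have hyQ : y ∈ orthogonal v := fun i => by simpa using hy i.castSucc
    intro i
    induction i using Fin.lastCases with
    | last =>
      rw [Fin.snoc_last, beta_comm, so_beta, hP y hyQ _ (hx' X hX), neg_zero]
    | cast i =>
      rw [Fin.snoc_castSucc]
      exact hQ X hX y hyQ i
  -- If `x` is anisotropic, a second eigenvector is sought orthogonal to it. The bound `2 * k + 1 <
  -- n` leaves room for the one extra linear condition.
  obtain ⟨y, hyQ', hyP, hy⟩ := exists_eigenvector_mod_of_isSolvable hb hs hQ'
    (not_orthogonal_le (Fin.snoc v x : Fin (k + 1) → Fin n → ℂ) v (by omega))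
  have hyQ : y ∈ orthogonal v := fun i => by simpa using hyQ' i.castSucc
  have hxy : beta x y = 0 := by simpa using hyQ' (Fin.last k)
  by_cases hyy : beta y y = 0
  · exact ⟨y, hyP, hyQ, hyy, hy⟩
  have hy' := kill y hyQ hyy hy
  -- With this square root, `x + c • y` is isotropic. Every `X ∈ b` sends both `x` and `y` into `P`,
  -- so the combination is still an eigenvector modulo `P`; it lies outside `P` because its pairing
  -- with `x` is `beta x x`.
  obtain ⟨c, hc⟩ := IsAlgClosed.exists_pow_nat_eq (-(beta x x / beta y y)) (n := 2) (by norm_num)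
  refine ⟨x + c • y, fun hmem => ?_, fun i => ?_, ?_, fun X hX => ⟨0, ?_⟩⟩
  · have h1 := hP x hxQ _ hmem
    rw [beta_add_right, beta_smul_right, hxy, mul_zero, add_zero] at h1
    exact hxx h1
  · rw [beta_add_right, beta_smul_right, hxQ i, hyQ i, mul_zero, add_zero]
  · simp only [beta_add_right, beta_add_left, beta_smul_right, beta_smul_left, hxy,
      beta_comm y x]
    have h1 : c * (c * beta y y) = c ^ 2 * beta y y := by ring
    rw [mul_zero, add_zero, zero_add, h1, hc]
    field_simp
    ring
  · rw [zero_smul, sub_zero, Matrix.mulVec_add, Matrix.mulVec_smul]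
    exact add_mem (hx' X hX) (Submodule.smul_mem _ _ (hy' X hX))

theorem exists_isotropic_stable {n : ℕ} {b : LieSubalgebra ℂ (so n)}
    (hb : LieAlgebra.IsSolvable b) (k : ℕ) (hk : 2 * k ≤ n) (hn : n ≠ 2 * k) :
    ∃ v : Fin k → Fin n → ℂ, IsIsotropic v ∧ b ≤ stab v := by
  induction k with
  | zero => exact ⟨Fin.elim0, ⟨linearIndependent_empty_type, fun i => i.elim0⟩,
      fun X _ => mem_stab_of_forall fun i => i.elim0⟩
  | succ k ih =>
    obtain ⟨v, hv, hle⟩ := ih (by omega) (by omega)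
    have hs : ∀ X ∈ b, ∀ x ∈ Submodule.span ℂ (Set.range v),
        X.1 *ᵥ x ∈ Submodule.span ℂ (Set.range v) := by
      intro X hX x hx
      have h1 : Submodule.span ℂ (Set.range v) ≤
          (Submodule.span ℂ (Set.range v)).comap (Matrix.toLin' X.1) := by
        rw [Submodule.span_le]
        rintro _ ⟨i, rfl⟩
        have h2 := hle hX i _ (mem_flagSpan v le_rfl)
        exact Submodule.span_mono (Set.image_subset_range _ _) h2
      exact h1 hx
    obtain ⟨x, hxP, hvx, hxx, hx⟩ := exists_isotropic_extension hb (by omega) hs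
    have hsub : ∀ i : Fin k, flagSpan v i ≤
        flagSpan (Fin.snoc v x : Fin (k + 1) → Fin n → ℂ) i.castSucc := by
      intro i
      rw [flagSpan_le_iff]
      intro j hj
      have := mem_flagSpan (Fin.snoc v x : Fin (k + 1) → Fin n → ℂ)
        (Fin.castSucc_le_castSucc_iff.2 hj)
      rwa [Fin.snoc_castSucc] at this
    refine ⟨Fin.snoc v x, ⟨linearIndependent_finSnoc.2 ⟨hv.linearIndependent, hxP⟩, ?_⟩,
      fun X hX => mem_stab_of_forall fun i => ?_⟩
    · intro i j
      induction i using Fin.lastCases with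
      | last =>
        induction j using Fin.lastCases with
        | last => rw [Fin.snoc_last, hxx]
        | cast j => rw [Fin.snoc_last, Fin.snoc_castSucc, beta_comm, hvx]
      | cast i =>
        induction j using Fin.lastCases with
        | last => rw [Fin.snoc_last, Fin.snoc_castSucc, hvx]
        | cast j => rw [Fin.snoc_castSucc, Fin.snoc_castSucc, hv.beta_eq_zero]
    · induction i using Fin.lastCases with
      | last =>
        obtain ⟨c, hc⟩ := hx X hX
        have h1 : Submodule.span ℂ (Set.range v) ≤
            flagSpan (Fin.snoc v x : Fin (k + 1) → Fin n → ℂ) (Fin.last k) := by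
          rw [Submodule.span_le]
          rintro _ ⟨i, rfl⟩
          have := mem_flagSpan (Fin.snoc v x : Fin (k + 1) → Fin n → ℂ) (Fin.le_last i.castSucc)
          rwa [Fin.snoc_castSucc] at this
        have h2 : x ∈ flagSpan (Fin.snoc v x : Fin (k + 1) → Fin n → ℂ) (Fin.last k) := by
          have := mem_flagSpan (Fin.snoc v x : Fin (k + 1) → Fin n → ℂ) (le_refl (Fin.last k))
          rwa [Fin.snoc_last] at this
        rw [Fin.snoc_last, ← sub_add_cancel (X.1 *ᵥ x) (c • x)]
        exact add_mem (h1 hc) (Submodule.smul_mem _ _ h2)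
      | cast i =>
        rw [Fin.snoc_castSucc]
        exact hsub i (hle hX i _ (mem_flagSpan v le_rfl))

/-! ### Borel subalgebras are the stabilizers of isotropic flags -/

/-- A solvable algebra containing the stabilizer also stabilizes some isotropic flag, and that flag
must be the original one. -/
theorem IsIsotropic.isBorel_stab {l : ℕ} {v : Fin l → Fin (2 * l + 1) → ℂ}
    (hv : IsIsotropic v) : IsBorel (stab v) := by
  refine ⟨hv.isSolvable_stab, fun c hc hle => ?_⟩
  obtain ⟨v', hv', hcv⟩ := exists_isotropic_stable hc l (by omega) (by omega)
  rwa [stab_congr (flagSpan_eq_of_stab_le hv hv' (hle.trans hcv))]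

theorem IsBorel.exists_eq_stab {l : ℕ} {b : LieSubalgebra ℂ (so (2 * l + 1))} (hb : IsBorel b) :
    ∃ v : Fin l → Fin (2 * l + 1) → ℂ, IsIsotropic v ∧ b = stab v := by
  obtain ⟨v, hv, hle⟩ := exists_isotropic_stable hb.1 l (by omega) (by omega)
  exact ⟨v, hv, le_antisymm hle (hb.2 hv.isSolvable_stab hle)⟩

theorem IsBorel.exists_normalForm {l : ℕ} {b : LieSubalgebra ℂ (so (2 * l + 1))}
    (hb : IsBorel b) : ∃ w S v, NormalForm v w S ∧ b = stab v := by
  obtain ⟨v, hv, rfl⟩ := hb.exists_eq_stab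
  obtain ⟨v', w, S, h, hf⟩ := hv.exists_normalForm
  exact ⟨w, S, v', h, stab_congr hf.symm⟩

/-! ### Parametrization of the orbits -/

/-- The possible invariants of the orbits. -/
def OrbitData (l : ℕ) : Type :=
  {d : (Fin l → Fin (2 * l + 1)) × Finset (Fin l) // Admissible d.1 ∧ (∀ i ∈ d.2, mid l < d.1 i) ∧
    ∀ i ∈ d.2, ∀ j ∈ d.2, i < j → d.1 j < d.1 i}

theorem exists_orbitData {l : ℕ} (b : FlagVariety (2 * l + 1)) :
    ∃ d : OrbitData l, ∃ v, NormalForm v d.1.1 d.1.2 ∧ b.1 = stab v := by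
  obtain ⟨w, S, v, h, hb⟩ := b.2.exists_normalForm
  exact ⟨⟨(w, S), h.admissible, fun i hi => h.mid_lt hi, h.lt_of_lt⟩, v, h, hb⟩

/-- The invariants of a Borel subalgebra. -/
def orbitData {l : ℕ} (b : FlagVariety (2 * l + 1)) : OrbitData l := (exists_orbitData b).choose

theorem orbitData_spec {l : ℕ} (b : FlagVariety (2 * l + 1)) :
    ∃ v, NormalForm v (orbitData b).1.1 (orbitData b).1.2 ∧ b.1 = stab v :=
  (exists_orbitData b).choose_spec

/-- The chosen invariants do not depend on the choice: the stabilizer determines the flag, and the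
flag determines `(w, S)`. -/
theorem orbitData_eq {l : ℕ} {b : FlagVariety (2 * l + 1)} {v : Fin l → Fin (2 * l + 1) → ℂ}
    {d : OrbitData l} (h : NormalForm v d.1.1 d.1.2) (hb : b.1 = stab v) : orbitData b = d := by
  obtain ⟨v', h', hb'⟩ := orbitData_spec b
  obtain ⟨h1, h2⟩ := h'.eq_of_flagSpan_eq h
    (flagSpan_eq_of_stab_le h'.isIsotropic h.isIsotropic (by rw [← hb, ← hb']))
  exact Subtype.ext (Prod.ext h1 h2)

theorem orbitData_eq_iff {l : ℕ} (b c : FlagVariety (2 * l + 1)) :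
    orbitData b = orbitData c ↔ MulAction.orbitRel (borelSOEven l) (FlagVariety (2 * l + 1)) b c := by
  rw [MulAction.orbitRel_apply, MulAction.mem_orbit_iff]
  constructor
  · intro h
    obtain ⟨v, hv, hb⟩ := orbitData_spec b
    obtain ⟨v', hv', hc⟩ := orbitData_spec c
    rw [h] at hv
    obtain ⟨k, hk, hkv⟩ := hv'.exists_borelSOEven hv
    refine ⟨⟨k, hk⟩, Subtype.ext ?_⟩
    change c.1.map (Ad k) = b.1
    rw [hc, hb, ← stab_translate]
    congr 1
    exact funext hkv
  · rintro ⟨k, rfl⟩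
    obtain ⟨v, hv, hc⟩ := orbitData_spec c
    refine orbitData_eq (hv.map_borelSOEven k.2) ?_
    change c.1.map (Ad k.1) = _
    rw [hc, ← stab_translate]
    rfl

theorem orbitData_surjective (l : ℕ) :
    Function.Surjective (orbitData : FlagVariety (2 * l + 1) → OrbitData l) := by
  intro d
  obtain ⟨v, hv⟩ := NormalForm.exists_of_admissible d.2.1 d.2.2.1 d.2.2.2
  exact ⟨⟨stab v, hv.isIsotropic.isBorel_stab⟩, orbitData_eq hv rfl⟩

theorem card_orbits (l : ℕ) :
    Nat.card (MulAction.orbitRel.Quotient (borelSOEven l) (FlagVariety (2 * l + 1))) =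
      Nat.card (OrbitData l) := by
  refine Nat.card_congr (Equiv.ofBijective
    (Quotient.lift orbitData fun b c h => (orbitData_eq_iff b c).2 h) ⟨?_, ?_⟩)
  · intro p q
    induction p using Quotient.inductionOn
    induction q using Quotient.inductionOn
    exact fun h => Quotient.sound ((orbitData_eq_iff _ _).1 h)
  · exact fun d => (orbitData_surjective l d).imp' (fun b => ⟦b⟧) fun b hb => hb

/-! ### Counting the invariants -/

/-- A permutation that is decreasing on `S` is determined by its restriction to the complement
of `S`, which may be any injection. -/
theorem card_perm_strictAntiOn {l : ℕ} (S : Finset (Fin l)) :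
    Nat.card {σ : Equiv.Perm (Fin l) // StrictAntiOn σ S} = l.descFactorial (l - S.card) := by
  classical
  let f : {σ : Equiv.Perm (Fin l) // StrictAntiOn σ S} → ({i // i ∉ S} ↪ Fin l) := fun σ =>
    ⟨fun i => σ.1 i, fun i j h => Subtype.ext (σ.1.injective h)⟩
  have hf : Function.Bijective f := by
    constructor
    · rintro ⟨σ, hσ⟩ ⟨τ, hτ⟩ h
      have hout : ∀ i, i ∉ S → σ i = τ i := fun i hi => DFunLike.congr_fun h ⟨i, hi⟩
      -- Permutations that agree off `S` have the same image of `S`, and a decreasing map on `S` is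
      -- determined by its image.
      have himage : ∀ {σ τ : Equiv.Perm (Fin l)}, (∀ i, i ∉ S → σ i = τ i) →
          Set.range (fun i : S => OrderDual.toDual (σ i)) ⊆
            Set.range (fun i : S => OrderDual.toDual (τ i)) := by
        rintro σ τ hout _ ⟨i, rfl⟩
        have hm : τ.symm (σ i) ∈ S := by
          by_contra hm
          have h1 := hout _ hm
          rw [Equiv.apply_symm_apply] at h1
          rw [σ.injective h1] at hm
          exact hm i.2
        exact ⟨⟨_, hm⟩, by simp⟩
      have hmono : ∀ {σ : Equiv.Perm (Fin l)}, StrictAntiOn σ S →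
          StrictMono (fun i : S => OrderDual.toDual (σ i)) := fun hσ i j hij => hσ i.2 j.2 hij
      have hin := (StrictMono.range_inj (hmono hσ) (hmono hτ)).1
        (Set.Subset.antisymm (himage hout) (himage fun i hi => (hout i hi).symm))
      refine Subtype.ext (Equiv.ext fun i => ?_)
      by_cases hi : i ∈ S
      · exact OrderDual.toDual.injective (congrFun hin ⟨i, hi⟩)
      · exact hout i hi
    · intro g
      let T : Finset (Fin l) := (Finset.univ.map g)ᶜ
      have hT : T.card = S.card := by
        have h1 := S.card_le_univ
        rw [Fintype.card_fin] at h1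
        simp only [T, Finset.card_compl, Finset.card_map, Finset.card_univ, Fintype.card_fin]
        rw [Fintype.card_subtype_compl]
        simp
        omega
      -- The unique decreasing bijection from `S` onto the values that `g` omits.
      let e : S → T := fun i => T.orderIsoOfFin hT ((S.orderIsoOfFin rfl).symm i).rev
      have he : StrictAnti e := fun i j hij => by
        simpa [e] using hij
      let s : Fin l → Fin l := fun i => if h : i ∈ S then e ⟨i, h⟩ else g ⟨i, h⟩
      have hTg : ∀ (t : T) i, (t : Fin l) ≠ g i := by
        intro t i h
        have := t.2
        simp only [T, Finset.mem_compl, Finset.mem_map, not_exists, not_and] at this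
        exact this i (Finset.mem_univ _) h.symm
      have hs : Function.Injective s := by
        intro i j hij
        by_cases hi : i ∈ S <;> by_cases hj : j ∈ S
        · simp only [s, dif_pos hi, dif_pos hj] at hij
          exact congrArg Subtype.val (he.injective (Subtype.ext hij))
        · simp only [s, dif_pos hi, dif_neg hj] at hij
          exact absurd hij (hTg _ _)
        · simp only [s, dif_neg hi, dif_pos hj] at hij
          exact absurd hij.symm (hTg _ _)
        · simp only [s, dif_neg hi, dif_neg hj] at hij
          exact congrArg Subtype.val (g.injective hij)
      refine ⟨⟨Equiv.ofBijective s (Finite.injective_iff_bijective.1 hs), fun i hi j hj hij => ?_⟩,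
        ?_⟩
      · have hi' : i ∈ S := hi
        have hj' : j ∈ S := hj
        simp only [Equiv.ofBijective_apply, s, dif_pos hi', dif_pos hj']
        exact he hij
      · ext i
        simp [f, s, i.2]
  rw [Nat.card_congr (Equiv.ofBijective f hf), Nat.card_eq_fintype_card, Fintype.card_embedding_eq,
    Fintype.card_fin, Fintype.card_subtype_compl]
  simp

/-- The `t`-th index after the middle one. -/
def upIndex {l : ℕ} (t : Fin l) : Fin (2 * l + 1) := ⟨l + 1 + t, by omega⟩

theorem mid_lt_upIndex {l : ℕ} (t : Fin l) : mid l < upIndex t := by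
  simp only [mid, upIndex, Fin.lt_def]
  omega

theorem upIndex_rev_lt_mid {l : ℕ} (t : Fin l) : (upIndex t).rev < mid l := by
  simp only [mid, upIndex, Fin.lt_def, Fin.val_rev]
  omega

theorem upIndex_lt_upIndex {l : ℕ} {s t : Fin l} : upIndex s < upIndex t ↔ s < t := by
  rw [Fin.lt_def, Fin.lt_def]
  simp only [upIndex]
  omega

theorem upIndex_injective {l : ℕ} : Function.Injective (upIndex : Fin l → Fin (2 * l + 1)) := by
  intro s t h
  simpa [upIndex, Fin.ext_iff] using h

theorem exists_upIndex {l : ℕ} {r : Fin (2 * l + 1)} (h : mid l < r) : ∃ t, r = upIndex t := by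
  simp only [mid, Fin.lt_def] at h
  refine ⟨⟨r.1 - (l + 1), by omega⟩, ?_⟩
  simp only [upIndex, Fin.ext_iff]
  omega

/-- An admissible `w` is a permutation of the `l` pairs of opposite indices with a choice of side in
each pair. On `S` the side is forced to be the upper one and the permutation must decrease; off `S`
the side is free. -/
theorem card_index {l : ℕ} (S : Finset (Fin l)) :
    Nat.card {w : Fin l → Fin (2 * l + 1) // Admissible w ∧ (∀ i ∈ S, mid l < w i) ∧
      ∀ i ∈ S, ∀ j ∈ S, i < j → w j < w i} =
      l.descFactorial (l - S.card) * 2 ^ (l - S.card) := by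
  classical
  let wf : Equiv.Perm (Fin l) → ({i // i ∉ S} → Bool) → Fin l → Fin (2 * l + 1) := fun σ s i =>
    if h : i ∈ S then upIndex (σ i)
      else if s ⟨i, h⟩ then upIndex (σ i) else (upIndex (σ i)).rev
  have hwf : ∀ σ s i, wf σ s i = upIndex (σ i) ∨ wf σ s i = (upIndex (σ i)).rev := by
    intro σ s i
    simp only [wf]
    split_ifs <;> simp
  have hup : ∀ t t' : Fin l, upIndex t ≠ (upIndex t').rev := fun t t' h =>
    absurd (mid_lt_upIndex t) (by rw [h]; exact (upIndex_rev_lt_mid t').not_gt)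
  have hin : ∀ σ s i, i ∈ S → wf σ s i = upIndex (σ i) := fun σ s i hi => by simp [wf, hi]
  have hσ : ∀ σ s σ' s' i j, wf σ s i = wf σ' s' j → σ i = σ' j := by
    intro σ s σ' s' i j h
    rcases hwf σ s i with h1 | h1 <;> rcases hwf σ' s' j with h2 | h2 <;> rw [h1, h2] at h
    · exact upIndex_injective h
    · exact absurd h (hup _ _)
    · exact absurd h.symm (hup _ _)
    · exact upIndex_injective (Fin.rev_injective h)
  have hadm : ∀ σ s, Admissible (wf σ s) := by
    intro σ s
    refine ⟨fun i j h => σ.injective (hσ σ s σ s i j h), fun i j h => ?_⟩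
    have hij : i = j := by
      rcases hwf σ s i with h1 | h1 <;> rcases hwf σ s j with h2 | h2 <;> rw [h1, h2] at h
      · exact absurd h (hup _ _)
      · rw [Fin.rev_rev] at h
        exact σ.injective (upIndex_injective h)
      · exact σ.injective (upIndex_injective (Fin.rev_injective h))
      · rw [Fin.rev_rev] at h
        exact absurd h.symm (hup _ _)
    subst hij
    rcases hwf σ s i with h1 | h1 <;> rw [h1] at h
    · exact hup _ _ h
    · rw [Fin.rev_rev] at h
      exact hup _ _ h.symm
  let f : {σ : Equiv.Perm (Fin l) // StrictAntiOn σ S} × ({i // i ∉ S} → Bool) →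
      {w : Fin l → Fin (2 * l + 1) // Admissible w ∧ (∀ i ∈ S, mid l < w i) ∧
        ∀ i ∈ S, ∀ j ∈ S, i < j → w j < w i} := fun p =>
    ⟨wf p.1.1 p.2, hadm _ _, fun i hi => by rw [hin _ _ _ hi]; exact mid_lt_upIndex _,
      fun i hi j hj hij => by
        rw [hin _ _ _ hi, hin _ _ _ hj, upIndex_lt_upIndex]
        exact p.1.2 hi hj hij⟩
  have hf : Function.Bijective f := by
    constructor
    · rintro ⟨⟨σ, h1⟩, s⟩ ⟨⟨σ', h2⟩, s'⟩ h
      have h' : wf σ s = wf σ' s' := congrArg Subtype.val h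
      obtain rfl : σ = σ' := Equiv.ext fun i => hσ σ s σ' s' i i (congrFun h' i)
      have hs : s = s' := by
        funext i
        have hi := congrFun h' i
        simp only [wf, dif_neg i.2] at hi
        rcases hsi : s i <;> rcases hsi' : s' i <;> simp [hsi, hsi', hup, (hup _ _).symm] at hi ⊢
      rw [hs]
    · rintro ⟨w, hw, hwS, hwlt⟩
      have hex : ∀ i, ∃ t, w i = upIndex t ∨ w i = (upIndex t).rev := by
        intro i
        rcases lt_or_gt_of_ne (hw.ne_mid i) with h | h
        · have h1 : mid l < (w i).rev := by rwa [← mid_rev, Fin.rev_lt_rev]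
          obtain ⟨t, ht⟩ := exists_upIndex h1
          exact ⟨t, Or.inr (by rw [← ht, Fin.rev_rev])⟩
        · obtain ⟨t, ht⟩ := exists_upIndex h
          exact ⟨t, Or.inl ht⟩
      choose t ht using hex
      have htinj : Function.Injective t := by
        intro i j hij
        rcases ht i with h1 | h1 <;> rcases ht j with h2 | h2
        · exact hw.1 (by rw [h1, h2, hij])
        · exact absurd (by rw [h1, h2, hij, Fin.rev_rev]) (hw.2 i j)
        · exact absurd (by rw [h1, h2, hij]) (hw.2 i j)
        · exact hw.1 (by rw [h1, h2, hij])
      have htS : ∀ i ∈ S, w i = upIndex (t i) := by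
        intro i hi
        refine (ht i).resolve_right fun h => ?_
        have := hwS i hi
        rw [h] at this
        exact absurd this (upIndex_rev_lt_mid _).not_gt
      refine ⟨(⟨Equiv.ofBijective t (Finite.injective_iff_bijective.1 htinj),
        fun i hi j hj hij => ?_⟩, fun i => decide (w i = upIndex (t i))), Subtype.ext ?_⟩
      · have := hwlt i hi j hj hij
        rwa [htS i hi, htS j hj, upIndex_lt_upIndex] at this
      · funext i
        simp only [f, wf, Equiv.ofBijective_apply, decide_eq_true_eq]
        split_ifs with h1 h2
        · exact (htS i h1).symm
        · exact h2.symm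
        · exact ((ht i).resolve_left h2).symm
  rw [← Nat.card_congr (Equiv.ofBijective f hf), Nat.card_prod, card_perm_strictAntiOn,
    Nat.card_fun, Nat.card_eq_fintype_card (α := {i // i ∉ S}), Fintype.card_subtype_compl]
  simp

/-- The number of `w` for a given `S` depends only on its size, so subsets are grouped by
cardinality. -/
theorem card_orbitData (l : ℕ) :
    Nat.card (OrbitData l) =
      ∑ j ∈ Finset.range (l + 1), l.choose j * (l.descFactorial (l - j) * 2 ^ (l - j)) := by
  classical
  let e : OrbitData l ≃ Σ S : Finset (Fin l), {w : Fin l → Fin (2 * l + 1) //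
      Admissible w ∧ (∀ i ∈ S, mid l < w i) ∧ ∀ i ∈ S, ∀ j ∈ S, i < j → w j < w i} :=
    { toFun := fun d => ⟨d.1.2, d.1.1, d.2⟩
      invFun := fun p => ⟨(p.2.1, p.1), p.2.2⟩ }
  rw [Nat.card_congr e, Nat.card_sigma]
  simp only [card_index]
  have h := Finset.sum_powerset_apply_card
    (x := (Finset.univ : Finset (Fin l)))
    (fun j => l.descFactorial (l - j) * 2 ^ (l - j))
  rw [Finset.powerset_univ] at h
  simpa using h

end FlagOrbits
end

/-- The substitution `k = 1 + j` with `j` the size of `S`. The exponent is written `l + 1 - k`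
because the truncated `l - k + 1` would be `1` instead of `0` at `k = l + 1`. -/
theorem propositionp (l : ℕ) :
    (Nat.card (MulAction.orbitRel.Quotient (FlagOrbits.borelSOEven l)
        (FlagOrbits.FlagVariety (2 * l + 1))) : ℚ) =
      ∑ k ∈ Finset.Icc 1 (l + 1),
        (l ! : ℚ) / ((k - 1)! : ℚ) * (l.choose (k - 1) : ℚ) * 2 ^ (l + 1 - k) := by
  have hI : Finset.Icc 1 (l + 1) = Finset.Ico 1 (l + 2) := rfl
  rw [FlagOrbits.card_orbits, FlagOrbits.card_orbitData, hI, Finset.sum_Ico_eq_sum_range,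
    Nat.cast_sum]
  refine Finset.sum_congr (by simp) fun j hj => ?_
  have hj' : j ≤ l := by simpa [Nat.lt_succ_iff] using hj
  have h1 := Nat.factorial_mul_descFactorial (Nat.sub_le l j)
  rw [Nat.sub_sub_self hj'] at h1
  have h2 : (j ! : ℚ) ≠ 0 := by positivity
  have h3 : l + 1 - (1 + j) = l - j := by omega
  rw [h3, Nat.add_sub_cancel_left, ← h1]
  push_cast
  field_simp
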